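/- **Setting.** $M\ge 1$ agents play the same stochastic $K$-armed bandit ($K\ge1$) for $T$ synchronized time steps, where $T>\max\{\frac{M\log M}{K},M,K,2\}$. Arm $k$ has a reward distribution $\mathcal P_k$ supported on $[0,1]$ with mean $\mu(k)$; $\mu^*=\max_k\mu(k)$ and $\Delta_k=\mu^*-\mu(k)$. At each time step $t$ each agent $i$ pulls an arm $a_{t,i}$ and receives a reward drawn independently from $\mathcal P_{a_{t,i}}$. The regret is $REG(T)=\sum_{t=1}^T\sum_{i=1}^M(\mu^*-\mu(a_{t,i}))$, and the communication cost is the number of integers and real numbers sent between the server and the agents. **DEMAB with $D=l_0=0$.** Let $m_l=\lceil 4^{l+3}\log(MKT)\rceil$. Public random numbers $r_1,\dots,r_K$, independent and uniform on $[M]$, are drawn at no communication cost, and $B_1^{(i)}=\{a\in[K]: r_a=i\}$. The phases $l=1,2,\dots$ are executed until $T$ time steps have elapsed. Let $B_l$ be the set of arms remaining at the start of phase $l$ and $N_l=|B_l|$. The protocol starts in distributed mode. *Distributed mode.* The agents send $n^{(i)}=|B_l^{(i)}|$ to the server. If $N_l\le M$, they send their arms to the server, and the protocol continues in centralized mode,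 from this phase on. Otherwise, if $\max_i n^{(i)}>2\min_i n^{(i)}$, arms are reallocated: the server announces $\bar n=\lfloor N_l/M\rfloor$, every agent with more than $\bar n$ arms donates its surplus (chosen by any fixed rule) to the server, and the server sends the donated arms to the agents so as to fill each up to $\bar n$ arms, and then sends the $N_l \bmod M$ remaining arms to the first $N_l\bmod M$ agents, one each. The server broadcasts the (updated) $n_{\max}=\max_i|B_l^{(i)}|$. Agent $i$ pulls each $a\in B_l^{(i)}$ $m_l$ times, with average reward $\hat u_l(a)$, and then pulls the arms of $B_l^{(i)}$ in round-robin for $(n_{\max}-|B_l^{(i)}|)m_l$ time steps. Every agent sends its best arm and that arm's average to the server, which broadcasts $u_l^*=\max_{a\in B_l}\hat u_l(a)$; then $B_{l+1}^{(i)}=\{a\in B_l^{(i)}:\hat u_l(a)+2^{-l}\ge u_l^*\}$. *Centralized mode.* The phase lasts $p_l=\lceil m_lN_l/M\rceil$ time steps. If $N_l$ divides $M$, each arm of $B_l$ is pulled by $M/N_l$ agents, $p_l$ times each. Otherwise $m_l$ pulls of each arm are assigned consecutively, in the order of the arms' indices, to agent $1$ until it has $p_l$ pulls, then to agent $2$,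 and so on, and the fewer than $M$ pulls that are left over are spread over $B_l$ in round-robin. The agents report the average rewards, the server computes the average $\hat u_l(a)$ of $m_l$ pulls of each $a\in B_l$, and $B_{l+1}=\{a\in B_l:\hat u_l(a)+2^{-l}\ge\max_{b\in B_l}\hat u_l(b)\}$. **Theorem.** There is a universal constant $C$ such that, for all $M,K,T$ and all reward distributions as above, DEMAB with $D=l_0=0$ has the following properties. 1. $\displaystyle\mathbb E[REG(T)]\le C\Big(\sum_{k:\Delta_k>0}\frac{\log T}{\Delta_k}+M\log M\Big)$. 2. For every $\delta\in(0,1)$, with probability at least $1-\delta$ the communication cost is at most $C\,M\log(T/\delta)$. 3. The expected communication cost is at most $C\,M\log T$. -/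

import Mathlib

open MeasureTheory ProbabilityTheory
open scoped ENNReal

namespace DEMAB

/-! ### The stochastic bandit instance -/

/-- The mean reward of arm `k`, whose reward distribution is `P k`. -/
noncomputable def mean {K : ℕ} (P : Fin K → Measure ℝ) (k : Fin K) : ℝ := ∫ y, y ∂(P k)

/-- The suboptimality gap of arm `k`: the largest mean reward minus the mean reward of `k`. -/
noncomputable def gap {K : ℕ} (P : Fin K → Measure ℝ) (k : Fin K) : ℝ :=
  (⨆ j, mean P j) - mean P k

/-- The randomness of the problem. `X t i k` is the reward that agent `i` receives if it pulls
arm `k` at time step `t` (time steps are numbered `0, 1, …`): these rewards are independent, and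
those of arm `k` have distribution `P k`. The public random numbers `r k`, one for each arm, are
independent and uniform on the set of agents, and independent of the rewards. -/
structure IsEnvironment {M K : ℕ} {Ω : Type*} [MeasurableSpace Ω] (P : Fin K → Measure ℝ)
    (X : ℕ → Fin M → Fin K → Ω → ℝ) (r : Fin K → Ω → Fin M) (μ : Measure Ω) : Prop where
  measurable_reward : ∀ t i k, Measurable (X t i k)
  law_reward : ∀ t i k, μ.map (X t i k) = P k
  indep_reward : iIndepFun (fun q : ℕ × Fin M × Fin K => X q.1 q.2.1 q.2.2) μ
  measurable_alloc : ∀ k, Measurable (r k)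
  law_alloc : ∀ k i, μ {ω | r k ω = i} = (M : ℝ≥0∞)⁻¹
  indep_alloc : iIndepFun r μ
  indep_reward_alloc :
    IndepFun (fun ω (q : ℕ × Fin M × Fin K) => X q.1 q.2.1 q.2.2 ω) (fun ω k => r k ω) μ

/-! ### The protocol -/

/-- Where the remaining arms are kept: in distributed mode agent `i` keeps its own set `B i`;
in centralized mode (after `Centralize`) the server keeps a single set. -/
inductive Holding (M K : ℕ) : Type
  | distributed (B : Fin M → Finset (Fin K)) : Holding M K
  | centralized (B : Finset (Fin K)) : Holding M K

/-- `m_l = ⌈4^(l+3) log (MKT)⌉`, the number of pulls of each remaining arm on which the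
estimates of phase `l` are based. -/
noncomputable def pullsPerArm (M K T l : ℕ) : ℕ :=
  ⌈(4 : ℝ) ^ (l + 3) * Real.log ((M : ℝ) * K * T)⌉₊

/-- The sizes of the agents' sets are balanced: the maximum is at most twice the minimum. -/
def Balanced {M K : ℕ} (B : Fin M → Finset (Fin K)) : Prop :=
  ∀ i j, (B i).card ≤ 2 * (B j).card

/-- The total number of arms kept by the agents. -/
def total {M K : ℕ} (B : Fin M → Finset (Fin K)) : ℕ := ∑ i, (B i).card

/-- The number of arms that agents donate to the server in `Reallocate`: every agent that has more
than `n̄ = ⌊N / M⌋` arms donates its surplus. -/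
def surplus {M K : ℕ} (B : Fin M → Finset (Fin K)) : ℕ :=
  ∑ i, ((B i).card - total B / M)

/-- `B'` is a possible outcome of `Reallocate` applied to `B`, where `n̄ = ⌊N / M⌋`. An agent with
more than `n̄` arms picks `n̄` of them to keep and donates the others; an agent with at most `n̄` arms
keeps them all. Out of the donated arms, the server fills up every agent to `n̄` arms, and then
sends the remaining `N mod M` arms to the first `N mod M` agents, one each. -/
def IsReallocation {M K : ℕ} (B B' : Fin M → Finset (Fin K)) : Prop :=
  (∀ i, ∃ kept, kept ⊆ B i ∧ kept ⊆ B' i ∧ kept.card = min (B i).card (total B / M)) ∧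
  (∀ i, (B' i).card = total B / M + if (i : ℕ) < total B % M then 1 else 0) ∧
  Pairwise (fun i j => Disjoint (B' i) (B' j)) ∧
  Finset.univ.biUnion B' = Finset.univ.biUnion B

/-- A rule by which `Reallocate` makes its choices: the outcome, for the phase number `l` and the
current (disjoint) sets of the agents. -/
def IsReallocationRule {M K : ℕ}
    (realloc : ℕ → (Fin M → Finset (Fin K)) → (Fin M → Finset (Fin K))) : Prop :=
  ∀ l B, Pairwise (fun i j => Disjoint (B i) (B j)) → IsReallocation B (realloc l B)

open Classical in
/-- The beginning of a phase. In distributed mode, if at most `M` arms remain, `Centralize` is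
called, otherwise, if the agents' sets are not balanced, `Reallocate` is called
(`realloc` gives its outcome). -/
noncomputable def prepare {M K : ℕ} (realloc : (Fin M → Finset (Fin K)) → (Fin M → Finset (Fin K))) :
    Holding M K → Holding M K
  | .distributed B =>
      if total B ≤ M then .centralized (Finset.univ.biUnion B)
      else if Balanced B then .distributed B
      else .distributed (realloc B)
  | .centralized B => .centralized B

/-- The element of the set of arms `B` with the `j`-th smallest index, counted from `0`. -/
noncomputable def nthArm {K : ℕ} [NeZero K] (B : Finset (Fin K)) (j : ℕ) : Fin K :=
  (B.sort (· ≤ ·)).getD j 0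

/-- `p = ⌈m N / M⌉`, the number of pulls of each agent in a centralized phase. -/
def pullsPerAgent {K : ℕ} (M m : ℕ) (B : Finset (Fin K)) : ℕ := (m * B.card + M - 1) / M

/-- The number of pulls that a centralized phase assigns to each arm before any filling up:
if `N ∣ M`, then `M / N` agents pull the arm `p` times each, otherwise `m` pulls are made. -/
def pullsAssigned {K : ℕ} (M m : ℕ) (B : Finset (Fin K)) : ℕ :=
  if B.card ∣ M then M / B.card * pullsPerAgent M m B else m

/-- The number of time steps of a phase. -/
def phaseLength {M K : ℕ} (m : ℕ) : Holding M K → ℕ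
  | .distributed B => (Finset.univ.sup fun i => (B i).card) * m
  | .centralized B => pullsPerAgent M m B

/-- The arm that agent `i` pulls at step `s = 0, 1, …` of a phase.

Distributed mode: agent `i` pulls each of its arms `m` times, and then pulls its arms in round-robin
until the phase is over.

Centralized mode: the `M p` pulls of the phase are numbered by agent, and for each agent by time.
They are assigned in this order, starting with the arm of smallest index; the pulls that are left
over when all arms have been served (fewer than `M`) are spread over the arms in round-robin. -/
noncomputable def armAt {M K : ℕ} [NeZero K] (m : ℕ) : Holding M K → ℕ → Fin M → Fin K
  | .distributed B, s, i =>
      if s < (B i).card * m then nthArm (B i) (s / m)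
      else nthArm (B i) ((s - (B i).card * m) % (B i).card)
  | .centralized B, s, i =>
      let q := (i : ℕ) * pullsPerAgent M m B + s
      let b := pullsAssigned M m B
      if q < B.card * b then nthArm B (q / b)
      else nthArm B ((q - B.card * b) % B.card)

/-- Whether the pull of agent `i` at step `s` of a phase is one of the `m` pulls of the arm that
enter its average reward. -/
def Counted {M K : ℕ} (m : ℕ) : Holding M K → ℕ → Fin M → Prop
  | .distributed B, s, i => s < (B i).card * m
  | .centralized B, s, i =>
      let q := (i : ℕ) * pullsPerAgent M m B + s
      let b := pullsAssigned M m B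
      q < B.card * b ∧ q % b < m

open Classical in
/-- `û(a)`, the average reward of the `m` counted pulls of arm `a` in a phase that begins after `t`
time steps; `x` is the table of rewards. -/
noncomputable def estimate {M K : ℕ} [NeZero K] (m : ℕ) (h : Holding M K)
    (x : ℕ → Fin M → Fin K → ℝ) (t : ℕ) (a : Fin K) : ℝ :=
  (∑ q ∈ (Finset.range (phaseLength m h) ×ˢ (Finset.univ : Finset (Fin M))) with
      Counted m h q.1 q.2 ∧ armAt m h q.1 q.2 = a,
    x (t + q.1) q.2 (armAt m h q.1 q.2)) / m

open Classical in
/-- Elimination at the end of phase `l`: arm `a` stays if and only if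
`û(a) + 2^(-l) ≥ û(a')` for every remaining arm `a'`. -/
noncomputable def eliminate {M K : ℕ} (l : ℕ) (u : Fin K → ℝ) : Holding M K → Holding M K
  | .distributed B =>
      .distributed fun i => {a ∈ B i | ∀ j, ∀ a' ∈ B j, u a' ≤ u a + (1 / 2 : ℝ) ^ l}
  | .centralized B =>
      .centralized {a ∈ B | ∀ a' ∈ B, u a' ≤ u a + (1 / 2 : ℝ) ^ l}

/-- The protocol between two phases: the number of time steps elapsed, and the remaining arms. -/
structure State (M K : ℕ) : Type where
  time : ℕ
  holding : Holding M K

/-- The state after `n` phases, that is, before phase `l = n + 1`, with `D = l₀ = 0`: there is no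
burn-in stage, every arm `k` is initially kept by agent `ρ k`, and the first phase is phase `1`.
The horizon `T` enters here through the numbers of pulls only; the execution is cut off after `T`
time steps in `action` and `commCost` below. -/
noncomputable def run {M K : ℕ} [NeZero K] (T : ℕ)
    (realloc : ℕ → (Fin M → Finset (Fin K)) → (Fin M → Finset (Fin K)))
    (x : ℕ → Fin M → Fin K → ℝ) (ρ : Fin K → Fin M) : ℕ → State M K
  | 0 => ⟨0, .distributed fun i => {k | ρ k = i}⟩
  | n + 1 =>
      let S := run T realloc x ρ n
      let m := pullsPerArm M K T (n + 1)
      let h := prepare (realloc (n + 1)) S.holding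
      ⟨S.time + phaseLength m h, eliminate (n + 1) (estimate m h x S.time) h⟩

/-- The arm pulled by agent `i` at time step `t` (counted from `0`). As every phase takes at least
one time step, the phase at time `t` is the last of the phases `1, …, t + 1` that begins after at
most `t` time steps. -/
noncomputable def action {M K : ℕ} [NeZero K] (T : ℕ)
    (realloc : ℕ → (Fin M → Finset (Fin K)) → (Fin M → Finset (Fin K)))
    (x : ℕ → Fin M → Fin K → ℝ) (ρ : Fin K → Fin M) (t : ℕ) (i : Fin M) : Fin K :=
  let n := Nat.findGreatest (fun n => (run T realloc x ρ n).time ≤ t) t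
  let S := run T realloc x ρ n
  armAt (pullsPerArm M K T (n + 1)) (prepare (realloc (n + 1)) S.holding) (t - S.time) i

/-- The total regret `∑_{t ≤ T} ∑_i (μ* - μ(a_{t,i}))`, where `μ*` is the largest mean. -/
noncomputable def regret {M K : ℕ} [NeZero K] (P : Fin K → Measure ℝ) (T : ℕ)
    (realloc : ℕ → (Fin M → Finset (Fin K)) → (Fin M → Finset (Fin K)))
    (x : ℕ → Fin M → Fin K → ℝ) (ρ : Fin K → Fin M) : ℝ :=
  ∑ t ∈ Finset.range T, ∑ i, gap P (action T realloc x ρ t i)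

/-! ### Communication: the number of integers and real numbers sent between server and agents -/

open Classical in
/-- Messages sent by `prepare`. In distributed mode the agents send the sizes of their sets (`M`).
If `Centralize` is called, the server calls for the sets (`M`) and the agents send them (`N`).
If `Reallocate` is called, the server sends the word `reallocation` and `n̄` to all agents (`2 M`),
and every donated arm is sent to the server and from there to its new agent. If the phase is
distributed, the server then sends the largest size of an agent's set to all agents (`M`). -/
noncomputable def prepareCost {M K : ℕ} : Holding M K → ℕ
  | .distributed B =>
      if total B ≤ M then M + (M + total B)
      else if Balanced B then M + M
      else M + (2 * M + 2 * surplus B) + M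
  | .centralized _ => 0

open Classical in
/-- Messages sent when the pulls are scheduled. In distributed mode there are none. In centralized
mode, each agent is sent, for every arm that it has to pull, the arm, the number of pulls, and how
many of these are counted. -/
noncomputable def scheduleCost {M K : ℕ} [NeZero K] (m : ℕ) : Holding M K → ℕ
  | .distributed _ => 0
  | .centralized B =>
      3 * (Finset.univ.filter fun q : Fin M × Fin K =>
        ∃ s < pullsPerAgent M m B, armAt m (.centralized B) s q.1 = q.2).card

open Classical in
/-- Messages sent at the end of a phase. In distributed mode every agent sends its best arm and the
average reward of that arm (`2 M`), and the server sends the largest average reward to all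
agents (`M`). In centralized mode every agent sends the average reward of the counted pulls of each
arm for which it made such pulls. -/
noncomputable def reportCost {M K : ℕ} [NeZero K] (m : ℕ) : Holding M K → ℕ
  | .distributed _ => 2 * M + M
  | .centralized B =>
      (Finset.univ.filter fun q : Fin M × Fin K =>
        ∃ s < pullsPerAgent M m B,
          Counted m (.centralized B) s q.1 ∧ armAt m (.centralized B) s q.1 = q.2).card

/-- The communication cost of the execution up to time `T`: the messages at the beginning of every
phase that begins after fewer than `T` time steps, and those at the end of every phase that is
completed within `T` time steps. As every phase takes at least one time step, only the first `T`
phases can contribute. -/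
noncomputable def commCost {M K : ℕ} [NeZero K] (T : ℕ)
    (realloc : ℕ → (Fin M → Finset (Fin K)) → (Fin M → Finset (Fin K)))
    (x : ℕ → Fin M → Fin K → ℝ) (ρ : Fin K → Fin M) : ℕ :=
  ∑ n ∈ Finset.range T,
    let S := run T realloc x ρ n
    let m := pullsPerArm M K T (n + 1)
    let h := prepare (realloc (n + 1)) S.holding
    (if S.time < T then prepareCost S.holding + scheduleCost m h else 0) +
      (if S.time + phaseLength m h ≤ T then reportCost m h else 0)

end DEMAB

namespace DEMAB

/-! ### Enumeration of a set of arms -/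

/-! Regret. Call an execution accurate if in each phase `l` the estimates of the remaining arms are
within `2^(-l) / 2` of the means. Then the best arm is never eliminated, and after `n` phases every
remaining arm has gap at most `2 * 2^(-n)` (`Accurate.gap_le`). A phase pulls each remaining arm `m`
times for its estimate; balance keeps the padding in distributed mode to `m` further pulls per arm,
and in centralized mode fewer than `M` pulls are left over (`sum_pulls_le`). Since `m` grows like
`4^l log (MKT)`, an arm of gap `Δ` contributes a geometric sum of order `log (MKT) / Δ`, and the
leftover pulls contribute `O(M)` in total (`Accurate.regret_le`). Hoeffding's inequality and a union
bound make inaccuracy so unlikely that even the trivial regret `M T` adds at most `1` in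
expectation.

Communication. Phase lengths grow like `4^l / M`, so `O(log T)` phases begin before time `T`. Each
of them costs `O(M)` messages, apart from the arms donated in reallocations. Before the first
reallocation every agent holds the remaining arms that the random allocation gave it; later
donations are paid for by eliminated arms, up to `M` per phase. Hence it is enough that the random
allocation splits every large set of remaining arms evenly (`sum_donated_le`, `commCost_le`).

The remaining set depends on the allocation only through which agent pulls which arm at what time.
The rewards used in a phase are fresh, so the set of remaining arms is a Markov chain whose law is
the same for every allocation (`measure_arms_eq`); it is therefore independent of the allocation.
Thus a Chernoff bound for a fixed set of arms applies to the random remaining set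
(`measure_alloc_arms_le`, `measure_not_spread_le`). -/

lemma nthArm_eq {K : ℕ} [NeZero K] (B : Finset (Fin K)) {j : ℕ} (hj : j < B.card) :
    nthArm B j = B.orderEmbOfFin rfl ⟨j, hj⟩ := by
  simp [nthArm, Finset.orderEmbOfFin_apply, hj]

lemma nthArm_mem {K : ℕ} [NeZero K] (B : Finset (Fin K)) {j : ℕ} (hj : j < B.card) :
    nthArm B j ∈ B := by
  rw [nthArm_eq B hj]
  exact Finset.orderEmbOfFin_mem _ _ _

lemma nthArm_inj {K : ℕ} [NeZero K] (B : Finset (Fin K)) {j k : ℕ} (hj : j < B.card)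
    (hk : k < B.card) (h : nthArm B j = nthArm B k) : j = k := by
  rw [nthArm_eq B hj, nthArm_eq B hk] at h
  simpa using h

lemma exists_nthArm_eq {K : ℕ} [NeZero K] {B : Finset (Fin K)} {a : Fin K} (ha : a ∈ B) :
    ∃ j < B.card, nthArm B j = a := by
  have : a ∈ Set.range (B.orderEmbOfFin rfl) := by
    rw [Finset.range_orderEmbOfFin]; exact ha
  obtain ⟨j, rfl⟩ := this
  exact ⟨j, j.2, nthArm_eq B j.2⟩

/-! ### Valid holdings -/

/-- The set of remaining arms. -/
def Holding.arms {M K : ℕ} : Holding M K → Finset (Fin K)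
  | .distributed B => Finset.univ.biUnion B
  | .centralized B => B

/-- The holdings that occur between two phases. -/
def Holding.Valid {M K : ℕ} : Holding M K → Prop
  | .distributed B => Pairwise (fun i j => Disjoint (B i) (B j)) ∧ (Finset.univ.biUnion B).Nonempty
  | .centralized B => B.Nonempty ∧ B.card ≤ M

/-- The holdings that occur during a phase. -/
def Holding.Ready {M K : ℕ} : Holding M K → Prop
  | .distributed B =>
      Pairwise (fun i j => Disjoint (B i) (B j)) ∧ (∀ i, (B i).Nonempty) ∧ Balanced B
  | .centralized B => B.Nonempty ∧ B.card ≤ M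

lemma card_biUnion_eq_total {M K : ℕ} {B : Fin M → Finset (Fin K)}
    (hB : Pairwise (fun i j => Disjoint (B i) (B j))) :
    (Finset.univ.biUnion B).card = total B :=
  Finset.card_biUnion fun _ _ _ _ hij => hB hij

/-- All shares are `n̄` or `n̄ + 1`, and `n̄ + 1 ≤ 2 n̄` because more than `M` arms remain. -/
lemma IsReallocation.ready {M K : ℕ} [NeZero M] {B B' : Fin M → Finset (Fin K)}
    (h : IsReallocation B B') (hM : M < total B) : (Holding.distributed B').Ready := by
  have h1 : 1 ≤ total B / M := (Nat.one_le_div_iff (NeZero.pos M)).2 hM.le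
  refine ⟨h.2.2.1, fun i => ?_, fun i j => ?_⟩
  · rw [← Finset.card_pos, h.2.1 i]; omega
  · rw [h.2.1 i, h.2.1 j]; split_ifs <;> omega

lemma prepare_ready {M K : ℕ} [NeZero M] {f : (Fin M → Finset (Fin K)) → (Fin M → Finset (Fin K))}
    (hf : ∀ B, Pairwise (fun i j => Disjoint (B i) (B j)) → IsReallocation B (f B))
    {h : Holding M K} (hh : h.Valid) : (prepare f h).Ready := by
  cases h with
  | centralized B => exact hh
  | distributed B =>
    simp only [prepare]
    split_ifs with h1 h2
    · exact ⟨hh.2, by rwa [card_biUnion_eq_total hh.1]⟩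
    · refine ⟨hh.1, fun i => ?_, h2⟩
      rw [← Finset.card_pos]
      -- An agent without arms would, by balance, force all agents to have none.
      by_contra hi
      have h0 : total B = 0 := Finset.sum_eq_zero fun j _ => by have := h2 j i; omega
      omega
    · exact (hf B hh.1).ready (by omega)

lemma arms_prepare {M K : ℕ} {f : (Fin M → Finset (Fin K)) → (Fin M → Finset (Fin K))}
    (hf : ∀ B, Pairwise (fun i j => Disjoint (B i) (B j)) → IsReallocation B (f B))
    {h : Holding M K} (hh : h.Valid) : (prepare f h).arms = h.arms := by
  cases h with
  | centralized B => rfl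
  | distributed B =>
    simp only [prepare]
    split_ifs with h1 h2
    · rfl
    · rfl
    · exact (hf B hh.1).2.2.2

lemma Holding.Ready.arms_nonempty {M K : ℕ} [NeZero M] {h : Holding M K} (hh : h.Ready) :
    h.arms.Nonempty := by
  cases h with
  | centralized B => exact hh.1
  | distributed B =>
    obtain ⟨a, ha⟩ := hh.2.1 0
    exact ⟨a, Finset.mem_biUnion.2 ⟨0, Finset.mem_univ _, ha⟩⟩

open Classical in
/-- The arms of `S` that survive the elimination of phase `l` based on the estimates `u`. -/
noncomputable def survivors {K : ℕ} (l : ℕ) (u : Fin K → ℝ) (S : Finset (Fin K)) :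
    Finset (Fin K) :=
  {a ∈ S | ∀ a' ∈ S, u a' ≤ u a + (1 / 2 : ℝ) ^ l}

lemma arms_eliminate {M K : ℕ} (l : ℕ) (u : Fin K → ℝ) (h : Holding M K) :
    (eliminate l u h).arms = survivors l u h.arms := by
  cases h with
  | centralized B => rfl
  | distributed B =>
    ext a
    simp only [eliminate, Holding.arms, survivors, Finset.mem_biUnion, Finset.mem_filter,
      Finset.mem_univ, true_and]
    constructor
    · rintro ⟨i, hi, h⟩
      exact ⟨⟨i, hi⟩, fun a' ⟨j, hj⟩ => h j a' hj⟩
    · rintro ⟨⟨i, hi⟩, h⟩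
      exact ⟨i, hi, fun j a' hj => h a' ⟨j, hj⟩⟩

lemma survivors_subset {K : ℕ} (l : ℕ) (u : Fin K → ℝ) (S : Finset (Fin K)) :
    survivors l u S ⊆ S := Finset.filter_subset _ _

lemma survivors_nonempty {K : ℕ} (l : ℕ) (u : Fin K → ℝ) {S : Finset (Fin K)} (hS : S.Nonempty) :
    (survivors l u S).Nonempty := by
  obtain ⟨a, ha, hmax⟩ := S.exists_max_image u hS
  refine ⟨a, Finset.mem_filter.2 ⟨ha, fun a' ha' => ?_⟩⟩
  have := hmax a' ha'
  have : (0 : ℝ) ≤ (1 / 2) ^ l := by positivity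
  linarith

lemma survivors_congr {K : ℕ} (l : ℕ) {u v : Fin K → ℝ} {S : Finset (Fin K)}
    (h : ∀ a ∈ S, u a = v a) : survivors l u S = survivors l v S := by
  ext a
  simp only [survivors, Finset.mem_filter]
  refine and_congr_right fun ha => forall₂_congr fun a' ha' => ?_
  rw [h a ha, h a' ha']

lemma eliminate_valid {M K : ℕ} [NeZero M] (l : ℕ) (u : Fin K → ℝ) {h : Holding M K}
    (hh : h.Ready) : (eliminate l u h).Valid := by
  have h1 : (eliminate l u h).arms.Nonempty := by
    rw [arms_eliminate]; exact survivors_nonempty l u hh.arms_nonempty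
  cases h with
  | centralized B => exact ⟨h1, (Finset.card_le_card (survivors_subset l u B)).trans hh.2⟩
  | distributed B =>
    exact ⟨fun i j hij => Finset.disjoint_of_subset_left (Finset.filter_subset _ _)
      (Finset.disjoint_of_subset_right (Finset.filter_subset _ _) (hh.1 hij)), h1⟩

/-! ### The pulls of a phase -/

/-- Turns the pulls of a centralized phase, indexed by step and agent, into one list of `M p`
consecutive pulls, in which every arm occupies an interval. -/
lemma sum_agent_step {M : ℕ} {β : Type*} [AddCommMonoid β] (p : ℕ) (F : ℕ → β) :
    ∑ q ∈ Finset.range p ×ˢ (Finset.univ : Finset (Fin M)), F ((q.2 : ℕ) * p + q.1) =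
      ∑ n ∈ Finset.range (M * p), F n := by
  refine Finset.sum_nbij (fun q => (q.2 : ℕ) * p + q.1) ?_ ?_ ?_ (fun _ _ => rfl)
  · rintro ⟨s, i⟩ h
    simp only [Finset.mem_product, Finset.mem_range, Finset.mem_univ, and_true] at h ⊢
    calc (i : ℕ) * p + s < i * p + p := by omega
      _ = (i + 1) * p := by ring
      _ ≤ M * p := Nat.mul_le_mul_right _ i.2
  · rintro ⟨s, i⟩ h ⟨s', i'⟩ h' e
    simp only [Finset.coe_product, Finset.coe_range, Finset.coe_univ, Set.mem_prod, Set.mem_Iio,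
      Set.mem_univ, and_true] at h h' e
    have hp : 0 < p := by omega
    have h1 : (i : ℕ) = i' := by
      have := congrArg (· / p) e
      simpa [Nat.add_div_of_dvd_right, Nat.mul_add_div, mul_comm _ p, Nat.div_eq_of_lt h,
        Nat.div_eq_of_lt h', hp] using this
    have h2 : s = s' := by rw [h1] at e; omega
    rw [h2, Fin.ext h1]
  · intro n hn
    simp only [Finset.coe_range, Set.mem_Iio] at hn
    have hp : 0 < p := Nat.pos_of_ne_zero (by rintro rfl; simp at hn)
    refine ⟨(n % p, ⟨n / p, Nat.div_lt_of_lt_mul (by rwa [mul_comm])⟩), ?_, ?_⟩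
    · simp [Nat.mod_lt _ hp]
    · simp only
      rw [mul_comm]; exact Nat.div_add_mod n p

lemma card_mul_le_mul_pullsPerAgent {M K : ℕ} [NeZero M] (m : ℕ) (B : Finset (Fin K)) :
    m * B.card ≤ M * pullsPerAgent M m B := by
  have := Nat.div_add_mod (m * B.card + M - 1) M
  have := Nat.mod_lt (m * B.card + M - 1) (NeZero.pos M)
  unfold pullsPerAgent
  have := NeZero.pos M
  omega

lemma mul_pullsPerAgent_le {M K : ℕ} (m : ℕ) (B : Finset (Fin K)) :
    M * pullsPerAgent M m B ≤ m * B.card + M - 1 := Nat.mul_div_le _ _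

lemma card_mul_pullsAssigned_le {M K : ℕ} [NeZero M] (m : ℕ) (B : Finset (Fin K)) :
    B.card * pullsAssigned M m B ≤ M * pullsPerAgent M m B := by
  unfold pullsAssigned
  split_ifs with h
  · rw [← mul_assoc, Nat.mul_div_cancel' h]
  · rw [mul_comm]; exact card_mul_le_mul_pullsPerAgent m B

lemma le_pullsAssigned {M K : ℕ} [NeZero M] (m : ℕ) {B : Finset (Fin K)} (hB : B.Nonempty) :
    m ≤ pullsAssigned M m B := by
  unfold pullsAssigned
  split_ifs with h
  · refine Nat.le_of_mul_le_mul_left ?_ hB.card_pos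
    rw [← mul_assoc, Nat.mul_div_cancel' h, mul_comm]
    exact card_mul_le_mul_pullsPerAgent m B
  · exact le_rfl

lemma armAt_mem {M K : ℕ} [NeZero K] {m : ℕ} {h : Holding M K} (hh : h.Ready)
    (s : ℕ) (i : Fin M) : armAt m h s i ∈ h.arms := by
  cases h with
  | centralized B =>
    simp only [armAt, Holding.arms]
    split_ifs with h1
    · exact nthArm_mem _ (Nat.div_lt_of_lt_mul (h1.trans_eq (mul_comm _ _)))
    · exact nthArm_mem _ (Nat.mod_lt _ hh.1.card_pos)
  | distributed B =>
    refine Finset.mem_biUnion.2 ⟨i, Finset.mem_univ _, ?_⟩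
    simp only [armAt]
    split_ifs with h1
    · exact nthArm_mem _ (Nat.div_lt_of_lt_mul (by rwa [mul_comm]))
    · exact nthArm_mem _ (Nat.mod_lt _ (hh.2.1 i).card_pos)

open Classical in
/-- The pulls on which the estimate of arm `a` is based. -/
noncomputable def countedPulls {M K : ℕ} [NeZero K] (m : ℕ) (h : Holding M K) (a : Fin K) :
    Finset (ℕ × Fin M) :=
  {q ∈ Finset.range (phaseLength m h) ×ˢ (Finset.univ : Finset (Fin M)) |
    Counted m h q.1 q.2 ∧ armAt m h q.1 q.2 = a}

lemma estimate_eq {M K : ℕ} [NeZero K] (m : ℕ) (h : Holding M K) (x : ℕ → Fin M → Fin K → ℝ)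
    (t : ℕ) (a : Fin K) :
    estimate m h x t a = (∑ q ∈ countedPulls m h a, x (t + q.1) q.2 a) / m := by
  classical
  unfold estimate countedPulls
  congr 1
  refine Finset.sum_congr rfl fun q hq => ?_
  rw [(Finset.mem_filter.1 hq).2.2]

/-- In distributed mode, disjointness leaves one agent for the arm, which pulls it in one block of
`m` steps. In centralized mode the arm owns a block of `b ≥ m` pulls in the common numbering, of
which the first `m` count. -/
lemma card_countedPulls {M K : ℕ} [NeZero M] [NeZero K] {m : ℕ} (hm : 0 < m) {h : Holding M K}
    (hh : h.Ready) {a : Fin K} (ha : a ∈ h.arms) : (countedPulls m h a).card = m := by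
  classical
  cases h with
  | distributed B =>
    obtain ⟨i, -, hai⟩ := Finset.mem_biUnion.1 ha
    obtain ⟨j₀, hj₀, hja⟩ := exists_nthArm_eq hai
    have : countedPulls m (.distributed B) a =
        (Finset.range m).image (fun j => (j₀ * m + j, i)) := by
      ext ⟨s, i'⟩
      rw [countedPulls, Finset.mem_filter]
      simp only [phaseLength, Counted, armAt, Finset.mem_product,
        Finset.mem_range, Finset.mem_univ, and_true, Finset.mem_image, Prod.mk.injEq]
      constructor
      · rintro ⟨-, h1, h2⟩
        rw [if_pos h1] at h2
        have h3 : s / m < (B i').card := Nat.div_lt_of_lt_mul (by rwa [mul_comm])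
        have h4 : a ∈ B i' := h2 ▸ nthArm_mem _ h3
        have h5 : i = i' := by
          by_contra hne
          exact Finset.disjoint_left.1 (hh.1 hne) hai h4
        subst h5
        have h6 : s / m = j₀ := nthArm_inj _ h3 hj₀ (h2.trans hja.symm)
        exact ⟨s % m, Nat.mod_lt _ hm, by rw [← h6, mul_comm]; exact Nat.div_add_mod s m, rfl⟩
      · rintro ⟨j, hj, rfl, rfl⟩
        have h1 : j₀ * m + j < (B i).card * m := by
          calc j₀ * m + j < (j₀ + 1) * m := by rw [add_mul, one_mul]; omega
            _ ≤ _ := Nat.mul_le_mul_right _ hj₀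
        refine ⟨h1.trans_le (Nat.mul_le_mul_right _
          (Finset.le_sup (f := fun i => (B i).card) (Finset.mem_univ i))), h1, ?_⟩
        rw [if_pos h1, ← hja]
        congr 1
        rw [mul_comm, Nat.mul_add_div hm, Nat.div_eq_of_lt hj, add_zero]
    rw [this, Finset.card_image_of_injective _ fun j j' h => by simpa using h, Finset.card_range]
  | centralized B =>
    obtain ⟨j₀, hj₀, hja⟩ := exists_nthArm_eq (show a ∈ B from ha)
    set b := pullsAssigned M m B with hb
    set p := pullsPerAgent M m B with hp
    have hmb : m ≤ b := le_pullsAssigned m hh.1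
    have hbp : B.card * b ≤ M * p := card_mul_pullsAssigned_le m B
    have h0 : 0 < b := by omega
    have e1 : (countedPulls m (.centralized B : Holding M K) a).card =
        ((Finset.range (M * p)).filter fun n => (n < B.card * b ∧ n % b < m) ∧
          (if n < B.card * b then nthArm B (n / b) else nthArm B ((n - B.card * b) % B.card)) = a).card := by
      rw [Finset.card_filter, ← sum_agent_step, countedPulls, Finset.card_filter]
      exact Finset.sum_congr rfl fun q _ => if_congr Iff.rfl rfl rfl
    have e2 : ((Finset.range (M * p)).filter fun n => (n < B.card * b ∧ n % b < m) ∧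
          (if n < B.card * b then nthArm B (n / b) else nthArm B ((n - B.card * b) % B.card)) = a) =
        (Finset.range m).image (fun j => j₀ * b + j) := by
      ext n
      simp only [Finset.mem_filter, Finset.mem_range, Finset.mem_image]
      constructor
      · rintro ⟨-, ⟨h1, h2⟩, h3⟩
        rw [if_pos h1] at h3
        have h4 : n / b = j₀ := nthArm_inj _ (Nat.div_lt_of_lt_mul (by rwa [mul_comm])) hj₀
          (h3.trans hja.symm)
        exact ⟨n % b, h2, by rw [← h4, mul_comm]; exact Nat.div_add_mod n b⟩
      · rintro ⟨j, hj, rfl⟩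
        have h1 : j₀ * b + j < B.card * b := by
          calc j₀ * b + j < (j₀ + 1) * b := by rw [add_mul, one_mul]; omega
            _ ≤ _ := Nat.mul_le_mul_right _ hj₀
        refine ⟨h1.trans_le hbp, ⟨h1, ?_⟩, ?_⟩
        · rw [mul_comm, Nat.mul_add_mod, Nat.mod_eq_of_lt (by omega)]; exact hj
        · rw [if_pos h1, ← hja]
          congr 1
          rw [mul_comm, Nat.mul_add_div h0, Nat.div_eq_of_lt (by omega), add_zero]
    rw [e1, e2, Finset.card_image_of_injective _ fun j j' h => by simpa using h, Finset.card_range]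

open Classical in
lemma sum_counted_pulls {M K : ℕ} [NeZero M] [NeZero K] {m : ℕ} (hm : 0 < m) {h : Holding M K}
    (hh : h.Ready) (f : Fin K → ℝ) :
    ∑ q ∈ Finset.range (phaseLength m h) ×ˢ (Finset.univ : Finset (Fin M)) with
      Counted m h q.1 q.2, f (armAt m h q.1 q.2) = m * ∑ a ∈ h.arms, f a := by
  rw [← Finset.sum_fiberwise_of_maps_to (t := h.arms) (g := fun q => armAt m h q.1 q.2)
    (fun q _ => armAt_mem hh _ _), Finset.mul_sum]
  refine Finset.sum_congr rfl fun a ha => ?_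
  rw [Finset.filter_filter, Finset.sum_congr rfl (g := fun _ => f a)
    fun q hq => by rw [(Finset.mem_filter.1 hq).2.2]]
  rw [Finset.sum_const, nsmul_eq_mul]
  congr 2
  exact card_countedPulls hm hh ha

open Classical in
-- By balance the phase lasts at most `2 n m` steps for an agent with `n` arms, so the round-robin
-- padding takes at most `n m` steps and returns to each arm at most `m` times.
lemma card_uncounted_le {M K : ℕ} [NeZero M] [NeZero K] {m : ℕ} {B : Fin M → Finset (Fin K)}
    (hh : (Holding.distributed B).Ready) (a : Fin K) :
    (Finset.card {q ∈ Finset.range (phaseLength m (.distributed B)) ×ˢ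
        (Finset.univ : Finset (Fin M)) |
      ¬ Counted m (.distributed B) q.1 q.2 ∧ armAt m (.distributed B) q.1 q.2 = a}) ≤ m := by
  by_cases ha : a ∈ (Holding.distributed B).arms
  swap
  · rw [Finset.filter_false_of_mem]
    · simp
    · rintro q - ⟨-, h⟩
      exact ha (h ▸ armAt_mem hh _ _)
  obtain ⟨i, -, hai⟩ := Finset.mem_biUnion.1 ha
  obtain ⟨j₀, hj₀, hja⟩ := exists_nthArm_eq hai
  have : {q ∈ Finset.range (phaseLength m (.distributed B)) ×ˢ
        (Finset.univ : Finset (Fin M)) |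
      ¬ Counted m (.distributed B) q.1 q.2 ∧ armAt m (.distributed B) q.1 q.2 = a} ⊆
      (Finset.range m).image fun j => ((B i).card * m + ((B i).card * j + j₀), i) := by
    rintro ⟨s, i'⟩ hq
    rw [Finset.mem_filter] at hq
    simp only [phaseLength, Counted, armAt, Finset.mem_product,
      Finset.mem_range, Finset.mem_univ, and_true, Finset.mem_image, Prod.mk.injEq] at hq ⊢
    obtain ⟨h0, h1, h2⟩ := hq
    rw [if_neg h1] at h2
    have hpos := (hh.2.1 i').card_pos
    have h3 := Nat.mod_lt (s - (B i').card * m) hpos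
    have h4 : a ∈ B i' := h2 ▸ nthArm_mem _ h3
    have h5 : i = i' := by
      by_contra hne
      exact Finset.disjoint_left.1 (hh.1 hne) hai h4
    subst h5
    have h6 := nthArm_inj _ h3 hj₀ (h2.trans hja.symm)
    have h7 : (Finset.univ.sup fun i => (B i).card) ≤ 2 * (B i).card :=
      Finset.sup_le fun j _ => hh.2.2 j i
    have h8 : s < 2 * (B i).card * m := h0.trans_le (Nat.mul_le_mul_right _ h7)
    refine ⟨(s - (B i).card * m) / (B i).card, ?_, ?_, rfl⟩
    · refine Nat.div_lt_of_lt_mul ?_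
      rw [mul_assoc] at h8
      omega
    · have := Nat.div_add_mod (s - (B i).card * m) (B i).card
      omega
  exact (Finset.card_le_card this).trans (Finset.card_image_le.trans (by simp))

/-- The bound covers both modes. Uncounted pulls at most double the cost in distributed mode; in
centralized mode there are at most `M - 1` of them, each costing at most `c`. -/
lemma sum_pulls_le {M K : ℕ} [NeZero M] [NeZero K] {m : ℕ} (hm : 0 < m) {h : Holding M K}
    (hh : h.Ready) (f : Fin K → ℝ) (hf : ∀ a, 0 ≤ f a) {c : ℝ} (hc : ∀ a ∈ h.arms, f a ≤ c) :
    ∑ q ∈ Finset.range (phaseLength m h) ×ˢ (Finset.univ : Finset (Fin M)),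
      f (armAt m h q.1 q.2) ≤ 2 * m * ∑ a ∈ h.arms, f a + (M - 1) * c := by
  classical
  have hc0 : 0 ≤ c := by
    obtain ⟨a, ha⟩ := hh.arms_nonempty
    exact (hf a).trans (hc a ha)
  have hM : (1 : ℝ) ≤ M := by exact_mod_cast NeZero.one_le
  have hs : 0 ≤ ∑ a ∈ h.arms, f a := Finset.sum_nonneg fun a _ => hf a
  rw [← Finset.sum_filter_add_sum_filter_not _ (fun q => Counted m h q.1 q.2),
    sum_counted_pulls hm hh f]
  cases h with
  | distributed B =>
    have key : ∑ q ∈ Finset.range (phaseLength m (.distributed B)) ×ˢ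
        (Finset.univ : Finset (Fin M)) with ¬ Counted m (.distributed B) q.1 q.2,
        f (armAt m (.distributed B) q.1 q.2) ≤ m * ∑ a ∈ (Holding.distributed B).arms, f a := by
      rw [← Finset.sum_fiberwise_of_maps_to (t := (Holding.distributed B).arms)
        (g := fun q => armAt m (.distributed B) q.1 q.2)
        (fun q _ => armAt_mem hh _ _), Finset.mul_sum]
      refine Finset.sum_le_sum fun a ha => ?_
      rw [Finset.filter_filter, Finset.sum_congr rfl (g := fun _ => f a)
        fun q hq => by rw [(Finset.mem_filter.1 hq).2.2], Finset.sum_const, nsmul_eq_mul]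
      refine mul_le_mul_of_nonneg_right ?_ (hf a)
      exact_mod_cast card_uncounted_le hh a
    have : 0 ≤ (M - 1 : ℝ) * c := mul_nonneg (by linarith) hc0
    linarith
  | centralized B =>
    have h1 := sum_counted_pulls hm hh (fun _ => (1 : ℝ))
    have h2 := Finset.card_filter_add_card_filter_not
      (s := Finset.range (phaseLength m (.centralized B : Holding M K)) ×ˢ
        (Finset.univ : Finset (Fin M))) (fun q => Counted m (.centralized B : Holding M K) q.1 q.2)
    rw [Finset.sum_const, Finset.sum_const, nsmul_eq_mul, nsmul_eq_mul, mul_one, mul_one] at h1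
    norm_cast at h1
    rw [h1, Finset.card_product, Finset.card_range, Finset.card_univ, Fintype.card_fin] at h2
    have h3 := mul_pullsPerAgent_le (M := M) m B
    simp only [phaseLength, Holding.arms] at h2
    have h4 : (Finset.card {q ∈ Finset.range (phaseLength m (.centralized B : Holding M K)) ×ˢ
        (Finset.univ : Finset (Fin M)) | ¬ Counted m (.centralized B : Holding M K) q.1 q.2}) ≤ M - 1 := by
      rw [mul_comm (pullsPerAgent M m B)] at h2
      simp only [phaseLength]
      omega
    have h5 : ∑ q ∈ Finset.range (phaseLength m (.centralized B : Holding M K)) ×ˢ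
        (Finset.univ : Finset (Fin M)) with ¬ Counted m (.centralized B : Holding M K) q.1 q.2,
        f (armAt m (.centralized B : Holding M K) q.1 q.2) ≤ (M - 1) * c := by
      refine (Finset.sum_le_card_nsmul _ _ c fun q _ => hc _ (armAt_mem hh _ _)).trans ?_
      rw [nsmul_eq_mul]
      refine mul_le_mul_of_nonneg_right ?_ hc0
      rw [← Nat.cast_one, ← Nat.cast_sub NeZero.one_le]
      exact_mod_cast h4
    have : 0 ≤ (m : ℝ) * ∑ a ∈ (Holding.centralized B : Holding M K).arms, f a := by positivity
    linarith

/-! ### The number of messages of a phase -/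

/-- Both coordinates are nondecreasing in `q`, so the points form a monotone staircase and the sum
of the coordinates determines the point. -/
lemma card_staircase_le (p b n : ℕ) :
    ((Finset.range n).image fun q => (q / p, q / b)).card ≤ (n - 1) / p + (n - 1) / b + 1 := by
  refine (Finset.card_le_card_of_injOn (t := Finset.range ((n - 1) / p + (n - 1) / b + 1))
    (fun z => z.1 + z.2) ?_ ?_).trans (by simp)
  · intro z hz
    obtain ⟨q, hq, rfl⟩ := Finset.mem_image.1 (Finset.mem_coe.1 hz)
    have hq' : q ≤ n - 1 := by rw [Finset.mem_range] at hq; omega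
    have h1 : q / p ≤ (n - 1) / p := Nat.div_le_div_right hq'
    have h2 : q / b ≤ (n - 1) / b := Nat.div_le_div_right hq'
    simp only [Finset.coe_range, Set.mem_Iio]
    omega
  · intro z hz w hw h
    obtain ⟨q, -, rfl⟩ := Finset.mem_image.1 (Finset.mem_coe.1 hz)
    obtain ⟨q', -, rfl⟩ := Finset.mem_image.1 (Finset.mem_coe.1 hw)
    simp only at h
    rcases le_total q q' with hqq | hqq
    · have h1 : q / p ≤ q' / p := Nat.div_le_div_right hqq
      have h2 : q / b ≤ q' / b := Nat.div_le_div_right hqq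
      ext <;> simp only <;> omega
    · have h1 : q' / p ≤ q / p := Nat.div_le_div_right hqq
      have h2 : q' / b ≤ q / b := Nat.div_le_div_right hqq
      ext <;> simp only <;> omega

open Classical in
lemma card_schedule_le {M K : ℕ} [NeZero M] [NeZero K] {m : ℕ} (hm : 0 < m) {B : Finset (Fin K)}
    (hB : B.Nonempty) (hM : B.card ≤ M) :
    (Finset.univ.filter fun q : Fin M × Fin K =>
      ∃ s < pullsPerAgent M m B, armAt m (.centralized B : Holding M K) s q.1 = q.2).card ≤ 3 * M := by
  set b := pullsAssigned M m B with hb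
  set p := pullsPerAgent M m B with hp
  set N := B.card with hN
  have hmb : m ≤ b := le_pullsAssigned m hB
  have hbp : N * b ≤ M * p := card_mul_pullsAssigned_le m B
  have hpm : M * p ≤ m * N + M - 1 := mul_pullsPerAgent_le m B
  have hN0 : 0 < N := hB.card_pos
  have hM0 : 0 < M := NeZero.pos M
  have hmN : m * N ≤ N * b := by rw [mul_comm]; exact Nat.mul_le_mul_left _ hmb
  have hNb : 0 < N * b := Nat.mul_pos hN0 (by omega)
  have hp0 : 0 < p := Nat.pos_of_ne_zero (by rintro h; rw [h] at hbp; omega)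
  have hlt : ∀ i : Fin M, ∀ s < p, (i : ℕ) * p + s < M * p := fun i s hs =>
    calc (i : ℕ) * p + s < (i + 1) * p := by rw [add_mul, one_mul]; omega
      _ ≤ M * p := Nat.mul_le_mul_right _ i.2
  have hdiv : ∀ i : Fin M, ∀ s < p, ((i : ℕ) * p + s) / p = i := fun i s hs => by
    rw [mul_comm, Nat.mul_add_div hp0, Nat.div_eq_of_lt hs, add_zero]
  -- Along the numbered pulls, a new agent-arm pair appears only when the agent changes (fewer than
  -- `M` times) or the arm changes (fewer than `N ≤ M` times). The leftover pulls, fewer than `M`,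
  -- are counted one by one.
  have hsub : (Finset.univ.filter fun q : Fin M × Fin K =>
      ∃ s < p, armAt m (.centralized B : Holding M K) s q.1 = q.2) ⊆
      (((Finset.range (N * b)).image fun q => (q / p, q / b)).image
        fun z => (Fin.ofNat M z.1, nthArm B z.2)) ∪
      (Finset.Ico (N * b) (M * p)).image
        fun q => (Fin.ofNat M (q / p), nthArm B ((q - N * b) % N)) := by
    rintro ⟨i, k⟩ h
    obtain ⟨s, hs, hk⟩ := (Finset.mem_filter.1 h).2
    simp only at hk
    subst hk
    have hi : Fin.ofNat M (((i : ℕ) * p + s) / p) = i := by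
      rw [hdiv i s hs]; simp
    by_cases hq : (i : ℕ) * p + s < N * b
    · refine Finset.mem_union_left _ (Finset.mem_image.2 ⟨_, Finset.mem_image.2
        ⟨_, Finset.mem_range.2 hq, rfl⟩, ?_⟩)
      simp only [armAt]
      rw [if_pos hq, hi]
    · refine Finset.mem_union_right _ (Finset.mem_image.2
        ⟨_, Finset.mem_Ico.2 ⟨not_lt.1 hq, hlt i s hs⟩, ?_⟩)
      simp only [armAt]
      rw [if_neg hq, hi]
  refine (Finset.card_le_card hsub).trans ((Finset.card_union_le _ _).trans ?_)
  have h1 : (N * b - 1) / p < M := Nat.div_lt_of_lt_mul (by rw [mul_comm p]; omega)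
  have h2 : (N * b - 1) / b < N := Nat.div_lt_of_lt_mul (by rw [mul_comm b]; omega)
  have h3 := Finset.card_image_le (s := (Finset.range (N * b)).image fun q => (q / p, q / b))
    (f := fun z => ((Fin.ofNat M z.1, nthArm B z.2) : Fin M × Fin K))
  have h4 := card_staircase_le p b (N * b)
  have h5 := Finset.card_image_le (s := Finset.Ico (N * b) (M * p))
    (f := fun q => ((Fin.ofNat M (q / p), nthArm B ((q - N * b) % N)) : Fin M × Fin K))
  rw [Nat.card_Ico] at h5
  omega

lemma scheduleCost_le {M K : ℕ} [NeZero M] [NeZero K] {m : ℕ} (hm : 0 < m) {h : Holding M K}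
    (hh : h.Ready) : scheduleCost m h ≤ 9 * M := by
  cases h with
  | distributed B => simp [scheduleCost]
  | centralized B =>
    have := card_schedule_le hm hh.1 hh.2
    simp only [scheduleCost]
    omega

lemma reportCost_le {M K : ℕ} [NeZero M] [NeZero K] {m : ℕ} (hm : 0 < m) {h : Holding M K}
    (hh : h.Ready) : reportCost m h ≤ 3 * M := by
  cases h with
  | distributed B => simp only [reportCost]; omega
  | centralized B =>
    refine le_trans (Finset.card_le_card ?_) (card_schedule_le hm hh.1 hh.2)
    intro q hq
    simp only [Finset.mem_filter, Finset.mem_univ, true_and] at hq ⊢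
    obtain ⟨s, hs, -, h⟩ := hq
    exact ⟨s, hs, h⟩

lemma le_mul_phaseLength {M K : ℕ} [NeZero M] {m : ℕ} {h : Holding M K} (hh : h.Ready) :
    m ≤ M * phaseLength m h := by
  have hM := NeZero.pos M
  cases h with
  | distributed B =>
    have h1 : 1 ≤ Finset.univ.sup fun i => (B i).card :=
      le_trans (hh.2.1 0).card_pos (Finset.le_sup (f := fun i => (B i).card) (Finset.mem_univ 0))
    simp only [phaseLength]
    calc m ≤ (Finset.univ.sup fun i => (B i).card) * m := Nat.le_mul_of_pos_left _ h1
      _ ≤ _ := Nat.le_mul_of_pos_left _ hM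
  | centralized B =>
    exact le_trans (Nat.le_mul_of_pos_right _ hh.1.card_pos) (card_mul_le_mul_pullsPerAgent m B)

/-! ### Numbers of pulls -/

lemma log_horizon_pos {M K T : ℕ} [NeZero M] [NeZero K] (hT : 2 < T) :
    1 < Real.log ((M : ℝ) * K * T) := by
  have hM : (1 : ℝ) ≤ M := by exact_mod_cast NeZero.one_le
  have hK : (1 : ℝ) ≤ K := by exact_mod_cast NeZero.one_le
  have hT' : (3 : ℝ) ≤ T := by exact_mod_cast hT
  have h1 : (3 : ℝ) ≤ (M : ℝ) * K * T := by nlinarith [mul_le_mul hM hK zero_le_one (by linarith)]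
  rw [Real.lt_log_iff_exp_lt (by linarith)]
  linarith [Real.exp_one_lt_d9]

lemma log_horizon_le {M K T : ℕ} [NeZero M] [NeZero K] (hM : M < T) (hK : K < T) :
    Real.log ((M : ℝ) * K * T) ≤ 3 * Real.log T := by
  have hM0 : (0 : ℝ) < M := by exact_mod_cast NeZero.pos M
  have hK0 : (0 : ℝ) < K := by exact_mod_cast NeZero.pos K
  have hT0 : (0 : ℝ) < T := by exact_mod_cast (NeZero.pos M).trans hM
  rw [Real.log_mul (by positivity) (by positivity), Real.log_mul (by positivity) (by positivity)]
  have h1 : Real.log M ≤ Real.log T := Real.log_le_log hM0 (by exact_mod_cast hM.le)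
  have h2 : Real.log K ≤ Real.log T := Real.log_le_log hK0 (by exact_mod_cast hK.le)
  linarith

lemma le_pullsPerArm (M K T l : ℕ) :
    (4 : ℝ) ^ (l + 3) * Real.log ((M : ℝ) * K * T) ≤ pullsPerArm M K T l := Nat.le_ceil _

lemma pow_le_pullsPerArm {M K T : ℕ} [NeZero M] [NeZero K] (hT : 2 < T) (l : ℕ) :
    4 ^ (l + 3) ≤ pullsPerArm M K T l := by
  have h1 := le_pullsPerArm M K T l
  have h2 := log_horizon_pos (M := M) (K := K) hT
  have h3 : (4 : ℝ) ^ (l + 3) ≤ pullsPerArm M K T l := by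
    refine le_trans ?_ h1
    exact le_mul_of_one_le_right (by positivity) h2.le
  exact_mod_cast h3

lemma pullsPerArm_pos {M K T : ℕ} [NeZero M] [NeZero K] (hT : 2 < T) (l : ℕ) :
    0 < pullsPerArm M K T l :=
  lt_of_lt_of_le (by positivity) (pow_le_pullsPerArm hT l)

lemma pullsPerArm_le {M K T : ℕ} [NeZero M] [NeZero K] (hT : 2 < T) (l : ℕ) :
    (pullsPerArm M K T l : ℝ) ≤ 2 * (4 ^ (l + 3) * Real.log ((M : ℝ) * K * T)) := by
  have h2 := log_horizon_pos (M := M) (K := K) hT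
  have h0 : (1 : ℝ) ≤ 4 ^ (l + 3) := one_le_pow₀ (by norm_num)
  have h1 : (1 : ℝ) ≤ 4 ^ (l + 3) * Real.log ((M : ℝ) * K * T) := by nlinarith
  have := (Nat.ceil_lt_add_one (zero_le_one.trans h1)).le
  unfold pullsPerArm
  linarith

/-! ### The phases of an execution -/

/-- The holding during phase `n + 1`. -/
noncomputable def phaseHolding {M K : ℕ} [NeZero K] (T : ℕ)
    (realloc : ℕ → (Fin M → Finset (Fin K)) → (Fin M → Finset (Fin K)))
    (x : ℕ → Fin M → Fin K → ℝ) (ρ : Fin K → Fin M) (n : ℕ) : Holding M K :=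
  prepare (realloc (n + 1)) (run T realloc x ρ n).holding

/-- The estimate of arm `a` in phase `n + 1`. -/
noncomputable def phaseEstimate {M K : ℕ} [NeZero K] (T : ℕ)
    (realloc : ℕ → (Fin M → Finset (Fin K)) → (Fin M → Finset (Fin K)))
    (x : ℕ → Fin M → Fin K → ℝ) (ρ : Fin K → Fin M) (n : ℕ) (a : Fin K) : ℝ :=
  estimate (pullsPerArm M K T (n + 1)) (phaseHolding T realloc x ρ n) x
    (run T realloc x ρ n).time a

section Run

variable {M K : ℕ} [NeZero K] {T : ℕ}
  {realloc : ℕ → (Fin M → Finset (Fin K)) → (Fin M → Finset (Fin K))}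
  (hr : IsReallocationRule realloc) (x : ℕ → Fin M → Fin K → ℝ) (ρ : Fin K → Fin M)

lemma run_succ_time (n : ℕ) : (run T realloc x ρ (n + 1)).time =
    (run T realloc x ρ n).time +
      phaseLength (pullsPerArm M K T (n + 1)) (phaseHolding T realloc x ρ n) := rfl

lemma run_succ_holding (n : ℕ) : (run T realloc x ρ (n + 1)).holding =
    eliminate (n + 1) (phaseEstimate T realloc x ρ n) (phaseHolding T realloc x ρ n) := rfl

variable [NeZero M]

include hr

lemma run_valid (n : ℕ) : (run T realloc x ρ n).holding.Valid := by
  induction n with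
  | zero =>
    refine ⟨fun i j hij => ?_, ⟨0, ?_⟩⟩
    · refine Finset.disjoint_left.2 fun a h1 h2 => ?_
      simp only [Finset.mem_filter, Finset.mem_univ, true_and] at h1 h2
      exact hij (h1.symm.trans h2)
    · simp
  | succ n ih => exact eliminate_valid _ _ (prepare_ready (hr _) ih)

lemma phaseHolding_ready (n : ℕ) : (phaseHolding T realloc x ρ n).Ready :=
  prepare_ready (hr _) (run_valid hr x ρ n)

lemma arms_phaseHolding (n : ℕ) :
    (phaseHolding T realloc x ρ n).arms = (run T realloc x ρ n).holding.arms :=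
  arms_prepare (hr _) (run_valid hr x ρ n)

lemma arms_run_succ (n : ℕ) : (run T realloc x ρ (n + 1)).holding.arms =
    survivors (n + 1) (phaseEstimate T realloc x ρ n) (run T realloc x ρ n).holding.arms := by
  rw [run_succ_holding, arms_eliminate, arms_phaseHolding hr]

lemma le_mul_run_time (hT : 2 < T) (n : ℕ) :
    4 ^ (n + 4) ≤ M * (run T realloc x ρ (n + 1)).time := by
  refine (pow_le_pullsPerArm (M := M) (K := K) hT (n + 1)).trans ?_
  refine (le_mul_phaseLength (phaseHolding_ready (T := T) hr x ρ n)).trans (Nat.mul_le_mul_left _ ?_)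
  rw [run_succ_time]
  exact Nat.le_add_left _ _

lemma run_time_strictMono (hT : 2 < T) : StrictMono fun n => (run T realloc x ρ n).time := by
  refine strictMono_nat_of_lt_succ fun n => ?_
  have h1 := le_mul_phaseLength (m := pullsPerArm M K T (n + 1)) (phaseHolding_ready (T := T) hr x ρ n)
  have h2 := pullsPerArm_pos (M := M) (K := K) hT (n + 1)
  have h3 := Nat.pos_of_mul_pos_left (h2.trans_le h1)
  rw [run_succ_time]
  omega

lemma action_eq (hT : 2 < T) (n s : ℕ) (i : Fin M)
    (hs : s < phaseLength (pullsPerArm M K T (n + 1)) (phaseHolding T realloc x ρ n)) :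
    action T realloc x ρ ((run T realloc x ρ n).time + s) i =
      armAt (pullsPerArm M K T (n + 1)) (phaseHolding T realloc x ρ n) s i := by
  have hmono := run_time_strictMono (T := T) hr x ρ hT
  have hn : Nat.findGreatest (fun k => (run T realloc x ρ k).time ≤ (run T realloc x ρ n).time + s)
      ((run T realloc x ρ n).time + s) = n := by
    refine Nat.findGreatest_eq_iff.2 ⟨?_, fun _ => Nat.le_add_right _ _, fun k hk _ => ?_⟩
    -- As phases have positive length, `n` phases take at least `n` steps, so the search bound of
    -- `findGreatest` does not cut off `n`.
    · exact (hmono.le_apply (x := n)).trans (Nat.le_add_right _ _)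
    · have h1 : (run T realloc x ρ (n + 1)).time ≤ (run T realloc x ρ k).time :=
        hmono.monotone (Nat.succ_le_of_lt hk)
      rw [run_succ_time] at h1
      omega
  simp only [action, hn, Nat.add_sub_cancel_left]
  rfl

lemma sum_action_eq (hT : 2 < T) (f : Fin K → ℝ) (n : ℕ) :
    ∑ t ∈ Finset.range (run T realloc x ρ n).time, ∑ i, f (action T realloc x ρ t i) =
      ∑ k ∈ Finset.range n,
        ∑ q ∈ Finset.range (phaseLength (pullsPerArm M K T (k + 1)) (phaseHolding T realloc x ρ k))
          ×ˢ (Finset.univ : Finset (Fin M)),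
        f (armAt (pullsPerArm M K T (k + 1)) (phaseHolding T realloc x ρ k) q.1 q.2) := by
  induction n with
  | zero => simp [run]
  | succ n ih =>
    rw [Finset.sum_range_succ, ← ih, run_succ_time, Finset.sum_range_add, Finset.sum_product]
    congr 1
    refine Finset.sum_congr rfl fun s hs => Finset.sum_congr rfl fun i _ => ?_
    rw [action_eq hr x ρ hT n s i (Finset.mem_range.1 hs)]

end Run

/-! ### Gaps -/

section Gap

variable {K : ℕ} (P : Fin K → Measure ℝ)

lemma gap_nonneg (k : Fin K) : 0 ≤ gap P k :=
  sub_nonneg.2 (le_ciSup (Set.finite_range _).bddAbove k)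

lemma exists_best_arm [NeZero K] : ∃ b, ∀ k, gap P k = mean P b - mean P k := by
  obtain ⟨b, hb⟩ := exists_eq_ciSup_of_finite (f := mean P)
  exact ⟨b, fun k => by rw [gap, hb]⟩

lemma mean_mem_Icc [∀ k, IsProbabilityMeasure (P k)]
    (hP : ∀ k, ∀ᵐ y ∂(P k), y ∈ Set.Icc (0 : ℝ) 1) (k : Fin K) : mean P k ∈ Set.Icc (0 : ℝ) 1 := by
  refine ⟨integral_nonneg_of_ae ((hP k).mono fun y hy => hy.1), ?_⟩
  have h := integral_mono_of_nonneg ((hP k).mono fun y hy => hy.1) (integrable_const (1 : ℝ))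
    ((hP k).mono fun y hy => hy.2)
  simpa [mean] using h

lemma gap_le_one [NeZero K] [∀ k, IsProbabilityMeasure (P k)]
    (hP : ∀ k, ∀ᵐ y ∂(P k), y ∈ Set.Icc (0 : ℝ) 1) (k : Fin K) : gap P k ≤ 1 := by
  obtain ⟨b, hb⟩ := exists_best_arm P
  rw [hb]
  linarith [(mean_mem_Icc P hP b).2, (mean_mem_Icc P hP k).1]

end Gap

/-! ### Regret of an accurate execution -/

/-- A geometric sum of ratio `4` is at most `4 / 3` times its last term, and the last admissible
term is at most `x ^ 2`. -/
lemma sum_pow_four_le (x : ℝ) (n : ℕ) :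
    ∑ k ∈ Finset.range n with (2 : ℝ) ^ k ≤ x, (4 : ℝ) ^ k ≤ 4 / 3 * x ^ 2 := by
  induction n with
  | zero => simp; positivity
  | succ n ih =>
    by_cases h : (2 : ℝ) ^ n ≤ x
    · calc ∑ k ∈ Finset.range (n + 1) with (2 : ℝ) ^ k ≤ x, (4 : ℝ) ^ k
          ≤ ∑ k ∈ Finset.range (n + 1), (4 : ℝ) ^ k :=
            Finset.sum_le_sum_of_subset_of_nonneg (Finset.filter_subset _ _)
              fun _ _ _ => by positivity
        _ = (4 ^ (n + 1) - 1) / 3 := by rw [geom_sum_eq (by norm_num)]; norm_num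
        _ ≤ 4 / 3 * ((2 : ℝ) ^ n) ^ 2 := by
            rw [← pow_mul, mul_comm n 2, pow_mul, pow_succ]; norm_num; linarith
        _ ≤ 4 / 3 * x ^ 2 := by gcongr
    · rw [Finset.range_add_one, Finset.filter_insert, if_neg h]
      exact ih

section Regret

variable {M K : ℕ} [NeZero K] {T : ℕ} (P : Fin K → Measure ℝ)
  {realloc : ℕ → (Fin M → Finset (Fin K)) → (Fin M → Finset (Fin K))}
  (hr : IsReallocationRule realloc) (x : ℕ → Fin M → Fin K → ℝ) (ρ : Fin K → Fin M)

/-- In the first `T` phases all estimates of remaining arms are accurate. -/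
def Accurate (T : ℕ) (realloc : ℕ → (Fin M → Finset (Fin K)) → (Fin M → Finset (Fin K)))
    (x : ℕ → Fin M → Fin K → ℝ) (ρ : Fin K → Fin M) : Prop :=
  ∀ n < T, ∀ a ∈ (run T realloc x ρ n).holding.arms,
    |phaseEstimate T realloc x ρ n a - mean P a| ≤ (1 / 2) ^ (n + 2)

lemma regret_le_mul (hP : ∀ k, gap P k ≤ 1) : regret P T realloc x ρ ≤ M * T := by
  refine (Finset.sum_le_sum fun t _ => Finset.sum_le_sum fun i _ => hP _).trans ?_
  simp [mul_comm]

variable [NeZero M]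

include hr

variable {P x ρ} in
-- The elimination tolerance is twice the accuracy. Two errors cannot make the best arm fall behind
-- by more than the tolerance, and a survivor has gap at most tolerance plus two errors, that is,
-- twice the tolerance.
lemma Accurate.gap_le (hx : Accurate P T realloc x ρ) {n : ℕ} (hn : n ≤ T)
    (hP : ∀ k, gap P k ≤ 1) :
    ∀ a ∈ (run T realloc x ρ n).holding.arms, gap P a ≤ 2 * (1 / 2) ^ n := by
  obtain ⟨b, hb⟩ := exists_best_arm P
  have key : b ∈ (run T realloc x ρ n).holding.arms ∧
      ∀ a ∈ (run T realloc x ρ n).holding.arms, gap P a ≤ 2 * (1 / 2) ^ n := by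
    induction n with
    | zero => exact ⟨by simp [run, Holding.arms], fun a _ => by simpa using (hP a).trans one_le_two⟩
    | succ n ih =>
      obtain ⟨h1, h2⟩ := ih (by omega)
      have h3 := hx n (by omega)
      have hp : (1 / 2 : ℝ) ^ (n + 2) + (1 / 2 : ℝ) ^ (n + 2) = (1 / 2) ^ (n + 1) := by ring
      rw [arms_run_succ hr]
      refine ⟨Finset.mem_filter.2 ⟨h1, fun a ha => ?_⟩, fun a ha => ?_⟩
      · have := abs_le.1 (h3 a ha)
        have := abs_le.1 (h3 b h1)
        have := gap_nonneg P a
        rw [hb] at this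
        linarith
      · obtain ⟨ha, ha'⟩ := Finset.mem_filter.1 ha
        have := abs_le.1 (h3 a ha)
        have := abs_le.1 (h3 b h1)
        have := ha' b h1
        rw [hb]
        linarith
  exact key.2

variable {P x ρ} in
lemma Accurate.regret_le (hT : 2 < T) (hx : Accurate P T realloc x ρ) (hP : ∀ k, gap P k ≤ 1) :
    regret P T realloc x ρ ≤
      5462 * (∑ k with 0 < gap P k, (gap P k)⁻¹ * Real.log ((M : ℝ) * K * T)) + 4 * (M - 1) := by
  set L := Real.log ((M : ℝ) * K * T) with hL
  have hL1 : 1 < L := log_horizon_pos hT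
  have hM : (1 : ℝ) ≤ M := by exact_mod_cast NeZero.one_le
  -- `T` phases take at least `T` steps, so the regret over `T` complete phases dominates.
  have h1 : regret P T realloc x ρ ≤
      ∑ t ∈ Finset.range (run T realloc x ρ T).time, ∑ i, gap P (action T realloc x ρ t i) :=
    Finset.sum_le_sum_of_subset_of_nonneg
      (Finset.range_mono (run_time_strictMono hr x ρ hT).le_apply)
      fun _ _ _ => Finset.sum_nonneg fun _ _ => gap_nonneg P _
  rw [sum_action_eq hr x ρ hT] at h1
  have h2 : ∀ n ∈ Finset.range T,
      ∑ q ∈ Finset.range (phaseLength (pullsPerArm M K T (n + 1)) (phaseHolding T realloc x ρ n))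
          ×ˢ (Finset.univ : Finset (Fin M)),
        gap P (armAt (pullsPerArm M K T (n + 1)) (phaseHolding T realloc x ρ n) q.1 q.2) ≤
      -- An arm of gap `Δ` present in phase `n + 1` satisfies `Δ ≤ 2 * 2^(-n)`, which is the
      -- condition of the `if`. The constant is `1024 = 2 * 2 * 256`: the padding, the rounding in
      -- `pullsPerArm_le`, and `4^(n+4) = 256 * 4^n`.
      (∑ k with 0 < gap P k, if (2 : ℝ) ^ n ≤ 2 / gap P k then 1024 * L * gap P k * 4 ^ n else 0)
        + (M - 1) * 2 * (1 / 2) ^ n := by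
    intro n hn
    have hg := hx.gap_le hr (Finset.mem_range.1 hn).le hP
    have h3 := sum_pulls_le (pullsPerArm_pos (M := M) (K := K) hT (n + 1))
      (phaseHolding_ready (T := T) hr x ρ n) (gap P) (gap_nonneg P) (c := 2 * (1 / 2) ^ n)
      (by rw [arms_phaseHolding hr]; exact hg)
    rw [arms_phaseHolding hr] at h3
    refine h3.trans ?_
    rw [← mul_assoc ((M : ℝ) - 1)]
    refine add_le_add_left ?_ _
    have h4 : ∑ a ∈ (run T realloc x ρ n).holding.arms, gap P a =
        ∑ a ∈ (run T realloc x ρ n).holding.arms with 0 < gap P a, gap P a := by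
      refine (Finset.sum_filter_of_ne fun a _ h => ?_).symm
      exact lt_of_le_of_ne (gap_nonneg P a) h.symm
    rw [h4, Finset.mul_sum]
    calc ∑ a ∈ (run T realloc x ρ n).holding.arms with 0 < gap P a,
          2 * (pullsPerArm M K T (n + 1) : ℝ) * gap P a
        ≤ ∑ a ∈ (run T realloc x ρ n).holding.arms with 0 < gap P a,
          (if (2 : ℝ) ^ n ≤ 2 / gap P a then 1024 * L * gap P a * 4 ^ n else 0) := by
          refine Finset.sum_le_sum fun a ha => ?_
          obtain ⟨ha, ha0⟩ := Finset.mem_filter.1 ha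
          have h5 := hg a ha
          rw [if_pos]
          · have h6 := pullsPerArm_le (M := M) (K := K) hT (n + 1)
            rw [← hL] at h6
            have h7 : (4 : ℝ) ^ (n + 1 + 3) = 256 * 4 ^ n := by ring
            rw [h7] at h6
            calc 2 * (pullsPerArm M K T (n + 1) : ℝ) * gap P a
                ≤ 2 * (2 * (256 * 4 ^ n * L)) * gap P a := by gcongr
              _ = 1024 * L * gap P a * 4 ^ n := by ring
          · rw [le_div_iff₀ ha0]
            calc (2 : ℝ) ^ n * gap P a ≤ 2 ^ n * (2 * (1 / 2) ^ n) := by gcongr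
              _ = 2 := by rw [one_div, inv_pow]; field_simp
      _ ≤ _ := by
          refine Finset.sum_le_sum_of_subset_of_nonneg
            (Finset.filter_subset_filter _ (Finset.subset_univ _)) fun a ha _ => ?_
          have := (Finset.mem_filter.1 ha).2
          split_ifs <;> positivity
  refine h1.trans ((Finset.sum_le_sum h2).trans ?_)
  rw [Finset.sum_add_distrib, Finset.sum_comm, Finset.mul_sum]
  refine add_le_add (Finset.sum_le_sum fun a ha => ?_) ?_
  · have ha0 := (Finset.mem_filter.1 ha).2
    rw [← Finset.sum_filter, ← Finset.mul_sum]
    calc 1024 * L * gap P a * ∑ k ∈ Finset.range T with (2 : ℝ) ^ k ≤ 2 / gap P a, (4 : ℝ) ^ k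
        ≤ 1024 * L * gap P a * (4 / 3 * (2 / gap P a) ^ 2) := by
          gcongr
          exact sum_pow_four_le _ _
      _ = 16384 / 3 * ((gap P a)⁻¹ * L) := by field_simp; ring
      _ ≤ 5462 * ((gap P a)⁻¹ * L) := by gcongr; norm_num
  · rw [← Finset.mul_sum, geom_sum_eq (by norm_num)]
    have : (0 : ℝ) < (1 / 2) ^ T := by positivity
    have h8 : ((1 / 2 : ℝ) ^ T - 1) / (1 / 2 - 1) ≤ 2 := by
      rw [div_le_iff_of_neg (by norm_num)]; linarith
    have : (0 : ℝ) ≤ (M - 1) * 2 := by linarith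
    nlinarith

end Regret

/-! ### The number of donated arms -/

/-- The part of `S` that the allocation `ρ` gives to each agent. -/
def split {M K : ℕ} (ρ : Fin K → Fin M) (S : Finset (Fin K)) (i : Fin M) : Finset (Fin K) :=
  {k ∈ S | ρ k = i}

open Classical in
/-- The number of arms donated at the beginning of a phase. -/
noncomputable def donated {M K : ℕ} : Holding M K → ℕ
  | .distributed B => if total B ≤ M then 0 else if Balanced B then 0 else surplus B
  | .centralized _ => 0

lemma prepareCost_le {M K : ℕ} (h : Holding M K) : prepareCost h ≤ 4 * M + 2 * donated h := by
  cases h with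
  | centralized B => simp [prepareCost]
  | distributed B =>
    simp only [prepareCost, donated]
    split_ifs <;> omega

lemma surplus_le_total {M K : ℕ} (B : Fin M → Finset (Fin K)) : surplus B ≤ total B :=
  Finset.sum_le_sum fun _ _ => Nat.sub_le _ _

lemma sum_even_shares {M : ℕ} [NeZero M] (c : ℕ) :
    ∑ i : Fin M, (c / M + if (i : ℕ) < c % M then 1 else 0) = c := by
  have h1 : ∑ i : Fin M, (if (i : ℕ) < c % M then 1 else 0) = c % M := by
    rw [Fin.sum_univ_eq_sum_range (fun i => if i < c % M then 1 else 0), ← Finset.card_filter]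
    have : Finset.filter (fun i => i < c % M) (Finset.range M) = Finset.range (c % M) := by
      ext i
      have := Nat.mod_lt c (NeZero.pos M)
      simp only [Finset.mem_filter, Finset.mem_range]
      omega
    rw [this, Finset.card_range]
  rw [Finset.sum_add_distrib, h1, Finset.sum_const, Finset.card_univ, Fintype.card_fin, smul_eq_mul]
  exact Nat.div_add_mod c M

/-- Bounds a reallocation after the previous one left `c` arms evenly shared. The larger of an
agent's size and the new `n̄` is still at most its old share, so surplus plus `M n̄` is at most `c`;
and `M n̄` falls short of the new total by less than `M`. Donations are thus paid for by the
eliminated arms, up to `M`. -/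
lemma surplus_add_total_le {M K : ℕ} [NeZero M] {B : Fin M → Finset (Fin K)} {c : ℕ}
    (h : ∀ i, (B i).card ≤ c / M + if (i : ℕ) < c % M then 1 else 0) :
    surplus B + total B ≤ c + M := by
  have h1 : total B ≤ c := (Finset.sum_le_sum fun i _ => h i).trans_eq (sum_even_shares c)
  have h2 : total B / M ≤ c / M := Nat.div_le_div_right h1
  have h3 : surplus B + M * (total B / M) ≤ c := by
    calc surplus B + M * (total B / M) = ∑ i, ((B i).card - total B / M + total B / M) := by
          rw [Finset.sum_add_distrib]; simp [surplus]
      _ ≤ ∑ i : Fin M, (c / M + if (i : ℕ) < c % M then 1 else 0) :=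
          Finset.sum_le_sum fun i _ => by have := h i; omega
      _ = c := sum_even_shares c
  have h4 := Nat.div_add_mod (total B) M
  have h5 := Nat.mod_lt (total B) (NeZero.pos M)
  omega

lemma eliminate_distributed_eq {M K : ℕ} {l : ℕ} {u : Fin K → ℝ} {h : Holding M K}
    {B' : Fin M → Finset (Fin K)} (he : eliminate l u h = .distributed B') :
    ∃ B, h = .distributed B ∧ ∀ i, B' i ⊆ B i := by
  cases h with
  | centralized B => cases he
  | distributed B =>
    refine ⟨B, rfl, fun i => ?_⟩
    simp only [eliminate, Holding.distributed.injEq] at he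
    rw [← he]
    exact Finset.filter_subset _ _

/-! ### Total donations, number of phases, and the resulting deterministic cost bound. -/

section Communication

variable {M K : ℕ} [NeZero M] [NeZero K] {T : ℕ}
  {realloc : ℕ → (Fin M → Finset (Fin K)) → (Fin M → Finset (Fin K))}
  (hr : IsReallocationRule realloc) (x : ℕ → Fin M → Fin K → ℝ) (ρ : Fin K → Fin M)

include hr

/-- The first reallocation can only occur when the original allocation splits the remaining arms
unevenly, hence with at most `H` of them. From then on the number `c` of arms at the last
reallocation is a potential: donations plus `c` grow by at most `M` per phase, starting from at most
`2 H`. -/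
lemma sum_donated_le {H : ℕ}
    (hH : ∀ n < T, Balanced (split ρ (run T realloc x ρ n).holding.arms) ∨
      (run T realloc x ρ n).holding.arms.card ≤ H) {n : ℕ} (hn : n ≤ T) :
    ∑ k ∈ Finset.range n, donated (run T realloc x ρ k).holding ≤ 2 * H + M * n := by
  -- Left: no arm has been donated and every arm is still with its original agent. Right: a
  -- reallocation has taken place, and sizes never exceed the even shares of `c`. Once the server
  -- holds the arms, the conditions on `B` are vacuous.
  suffices h : (∑ k ∈ Finset.range n, donated (run T realloc x ρ k).holding = 0 ∧
      ∀ B, (run T realloc x ρ n).holding = .distributed B → ∀ i, ∀ k ∈ B i, ρ k = i) ∨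
      ∃ c, ∑ k ∈ Finset.range n, donated (run T realloc x ρ k).holding + c ≤ 2 * H + M * n ∧
        ∀ B, (run T realloc x ρ n).holding = .distributed B →
          ∀ i, (B i).card ≤ c / M + if (i : ℕ) < c % M then 1 else 0 by
    rcases h with ⟨h, -⟩ | ⟨c, h, -⟩ <;> omega
  induction n with
  | zero =>
    refine Or.inl ⟨rfl, fun B hB i k hk => ?_⟩
    simp only [run, Holding.distributed.injEq] at hB
    subst hB
    simpa using hk
  | succ n ih =>
    have hval := run_valid (T := T) hr x ρ n
    have hHn := hH n (by omega)
    have ih := ih (by omega)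
    have hstep := run_succ_holding (T := T) (realloc := realloc) x ρ n
    rw [phaseHolding] at hstep
    simp only [Finset.sum_range_succ, hstep]
    have hMn : M * (n + 1) = M * n + M := by ring
    generalize hR : ∑ k ∈ Finset.range n, donated (run T realloc x ρ k).holding = R at ih ⊢
    generalize hh : (run T realloc x ρ n).holding = h at *
    cases h with
    | centralized B =>
      have hno : ∀ B', eliminate (n + 1) (phaseEstimate T realloc x ρ n)
          (prepare (realloc (n + 1)) (.centralized B)) ≠ .distributed B' := by
        intro B' h; cases h
      rcases ih with ⟨h, -⟩ | ⟨c, h, -⟩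
      · exact Or.inl ⟨by simp [donated, h], fun B' hB' => absurd hB' (hno B')⟩
      · exact Or.inr ⟨c, by simp only [donated]; omega, fun B' hB' => absurd hB' (hno B')⟩
    | distributed B =>
      by_cases h1 : total B ≤ M
      · have hno : ∀ B', eliminate (n + 1) (phaseEstimate T realloc x ρ n)
            (prepare (realloc (n + 1)) (.distributed B)) ≠ .distributed B' := by
          intro B' h
          simp only [prepare, if_pos h1] at h
          cases h
        rcases ih with ⟨h, -⟩ | ⟨c, h, -⟩
        · exact Or.inl ⟨by simp [donated, h, h1], fun B' hB' => absurd hB' (hno B')⟩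
        · exact Or.inr ⟨c, by simp only [donated, if_pos h1]; omega,
            fun B' hB' => absurd hB' (hno B')⟩
      by_cases h2 : Balanced B
      · have hd : donated (.distributed B) = 0 := by simp [donated, h1, h2]
        have hsub : ∀ B', eliminate (n + 1) (phaseEstimate T realloc x ρ n)
            (prepare (realloc (n + 1)) (.distributed B)) = .distributed B' → ∀ i, B' i ⊆ B i := by
          intro B' h
          obtain ⟨B'', e, hs⟩ := eliminate_distributed_eq h
          simp only [prepare, if_neg h1, if_pos h2, Holding.distributed.injEq] at e
          subst e
          exact hs
        rcases ih with ⟨h, hA⟩ | ⟨c, h, hB⟩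
        · exact Or.inl ⟨by omega, fun B' hB' i k hk => hA B rfl i k (hsub B' hB' i hk)⟩
        · exact Or.inr ⟨c, by omega, fun B' hB' i =>
            (Finset.card_le_card (hsub B' hB' i)).trans (hB B rfl i)⟩
      · have hd : donated (.distributed B) = surplus B := by simp [donated, h1, h2]
        have hrB := hr (n + 1) B hval.1
        refine Or.inr ⟨total B, ?_, fun B' hB' i => ?_⟩
        · rw [hd]
          rcases ih with ⟨h, hA⟩ | ⟨c, h, hB⟩
          · have hsplit : split ρ (Holding.distributed B).arms = B := by
              funext i
              ext k
              simp only [split, Holding.arms, Finset.mem_filter, Finset.mem_biUnion,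
                Finset.mem_univ, true_and]
              constructor
              · rintro ⟨⟨j, hj⟩, rfl⟩
                rwa [hA B rfl j k hj]
              · exact fun hk => ⟨⟨i, hk⟩, hA B rfl i k hk⟩
            rw [hsplit] at hHn
            have h3 := hHn.resolve_left h2
            simp only [Holding.arms] at h3
            rw [card_biUnion_eq_total hval.1] at h3
            have := surplus_le_total B
            omega
          · have := surplus_add_total_le (hB B rfl)
            omega
        · obtain ⟨B'', e, hs⟩ := eliminate_distributed_eq hB'
          simp only [prepare, if_neg h1, if_neg h2, Holding.distributed.injEq] at e
          subst e
          exact (Finset.card_le_card (hs i)).trans_eq (hrB.2.1 i)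

/-- Phase `k + 1` alone takes at least `4^(k+4) / M` steps, and `M T < T^2 < 4^k` as soon as `2^k >
T`. -/
lemma horizon_le_run_time (hT : 2 < T) (hM : M < T) {n : ℕ} (hn : Nat.log 2 T + 2 ≤ n) :
    T ≤ (run T realloc x ρ n).time := by
  obtain ⟨k, rfl⟩ : ∃ k, n = k + 1 := ⟨n - 1, by omega⟩
  by_contra! hlt
  have h1 := le_mul_run_time (T := T) hr x ρ hT k
  have h2 : T < 2 ^ k := (Nat.lt_pow_succ_log_self one_lt_two T).trans_le
    (Nat.pow_le_pow_right two_pos (by omega))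
  have h3 : M * (run T realloc x ρ (k + 1)).time ≤ T * T := Nat.mul_le_mul hM.le hlt.le
  have h4 : T * T < 2 ^ k * 2 ^ k := Nat.mul_lt_mul_of_lt_of_lt h2 h2
  have h5 : 2 ^ k * 2 ^ k = 4 ^ k := by rw [← Nat.mul_pow]
  have h6 : 4 ^ k ≤ 4 ^ (k + 4) := Nat.pow_le_pow_right (by norm_num) (by omega)
  omega

lemma commCost_le (hT : 2 < T) (hM : M < T) {H : ℕ}
    (hH : ∀ n < T, Balanced (split ρ (run T realloc x ρ n).holding.arms) ∨
      (run T realloc x ρ n).holding.arms.card ≤ H) :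
    commCost T realloc x ρ ≤ 18 * M * (Nat.log 2 T + 2) + 4 * H := by
  set L := Nat.log 2 T + 2 with hL
  have h1 : commCost T realloc x ρ ≤ ∑ n ∈ Finset.range T,
      -- `16 = 4 + 9 + 3`: preparation, schedule and report. Phases with `n ≥ L` begin after the
      -- horizon.
      if n < L then 16 * M + 2 * donated (run T realloc x ρ n).holding else 0 := by
    refine Finset.sum_le_sum fun n _ => ?_
    have hlt := run_time_strictMono (T := T) hr x ρ hT (Nat.lt_succ_self n)
    simp only [Nat.succ_eq_add_one] at hlt
    rw [run_succ_time, phaseHolding] at hlt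
    have hm := pullsPerArm_pos (M := M) (K := K) hT (n + 1)
    have hready := phaseHolding_ready (T := T) hr x ρ n
    have hs := scheduleCost_le hm hready
    have hrep := reportCost_le hm hready
    rw [phaseHolding] at hs hrep
    have hp := prepareCost_le (run T realloc x ρ n).holding
    have htime : ¬ n < L → T ≤ (run T realloc x ρ n).time := fun h =>
      horizon_le_run_time (T := T) hr x ρ hT hM (not_lt.1 h)
    dsimp only
    split_ifs <;> omega
  refine h1.trans ?_
  have h2 : (Finset.range T).filter (fun n => n < L) = Finset.range (min T L) := by
    ext n; simp
  rw [← Finset.sum_filter, h2, Finset.sum_add_distrib, ← Finset.mul_sum _ _ 2, Finset.sum_const,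
    Finset.card_range, smul_eq_mul]
  have h3 := sum_donated_le (T := T) hr x ρ hH (min_le_left T L)
  have h4 : M * min T L ≤ M * L := Nat.mul_le_mul_left _ (min_le_right _ _)
  calc min T L * (16 * M) + 2 * ∑ n ∈ Finset.range (min T L), donated (run T realloc x ρ n).holding
      ≤ 16 * (M * min T L) + 2 * (2 * H + M * min T L) := by
        refine add_le_add (le_of_eq (by ring)) (Nat.mul_le_mul_left _ h3)
    _ ≤ 18 * (M * L) + 4 * H := by omega
    _ = 18 * M * L + 4 * H := by ring

/-- A bound without exceptional event, since there are at most `K < T` arms; it controls the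
expectation on the event where the allocation is uneven. -/
lemma commCost_le_of_horizon (hT : 2 < T) (hM : M < T) (hK : K < T) :
    commCost T realloc x ρ ≤ 18 * M * (Nat.log 2 T + 2) + 4 * T := by
  refine commCost_le hr x ρ hT hM fun n _ => Or.inr ?_
  exact (Finset.card_le_univ _).trans (by simpa using hK.le)

end Communication

/-! ### The execution as a function of the rewards -/

/-- A holding is determined by its mode and by two finite sets. -/
def Holding.encode {M K : ℕ} : Holding M K → (Fin M → Finset (Fin K)) ⊕ Finset (Fin K)
  | .distributed B => .inl B
  | .centralized B => .inr B

lemma Holding.encode_injective {M K : ℕ} :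
    Function.Injective (Holding.encode : Holding M K → _) := by
  intro h h' e
  cases h <;> cases h' <;> simp_all [Holding.encode]

instance {M K : ℕ} : Countable (Holding M K) := Holding.encode_injective.countable

instance {M K : ℕ} : Countable (State M K) :=
  Function.Injective.countable (f := fun s : State M K => (s.time, s.holding)) fun s s' h => by
    cases s; cases s'; simpa using h

/-- Elimination sees the estimates only through finitely many comparisons, each a measurable
condition. -/
lemma measurableSet_eliminate_eq {M K : ℕ} (l : ℕ) (h h' : Holding M K) :
    MeasurableSet {u : Fin K → ℝ | eliminate l u h = h'} := by
  classical
  let R : (Fin K → ℝ) → Fin K × Fin K → Prop := fun u q => u q.2 ≤ u q.1 + (1 / 2 : ℝ) ^ l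
  have hR : Measurable R := measurable_pi_iff.2 fun q => measurableSet_setOfPred.1
    (measurableSet_le (measurable_pi_apply _) ((measurable_pi_apply _).add_const _))
  have key : ∃ G : (Fin K × Fin K → Prop) → Holding M K, ∀ u, eliminate l u h = G (R u) := by
    cases h with
    | distributed B =>
      exact ⟨fun r => .distributed fun i => {a ∈ B i | ∀ j, ∀ a' ∈ B j, r (a, a')}, fun u => rfl⟩
    | centralized B => exact ⟨fun r => .centralized {a ∈ B | ∀ a' ∈ B, r (a, a')}, fun u => rfl⟩
  obtain ⟨G, hG⟩ := key
  have : {u : Fin K → ℝ | eliminate l u h = h'} = R ⁻¹' {r | G r = h'} := by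
    ext u; simp [hG]
  rw [this]
  exact hR (Set.to_countable _).measurableSet

lemma measurableSet_survivors_eq {K : ℕ} (l : ℕ) (S S' : Finset (Fin K)) :
    MeasurableSet {u : Fin K → ℝ | survivors l u S = S'} := by
  have : {u : Fin K → ℝ | survivors l u S = S'} =
      {u : Fin K → ℝ | eliminate l u (.centralized S : Holding 1 K) = .centralized S'} := by
    ext u
    simp [eliminate, survivors]
  rw [this]
  exact measurableSet_eliminate_eq l _ _

section Measurability

variable {Ω : Type*} {M K : ℕ}

/-- The σ-algebra generated by the rewards before time `t`. -/
@[reducible] def past (X : ℕ → Fin M → Fin K → Ω → ℝ) (t : ℕ) : MeasurableSpace Ω :=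
  ⨆ q ∈ {q : ℕ × Fin M × Fin K | q.1 < t},
    MeasurableSpace.comap (X q.1 q.2.1 q.2.2) inferInstance

/-- The σ-algebra generated by the rewards from time `t` on. -/
@[reducible] def future (X : ℕ → Fin M → Fin K → Ω → ℝ) (t : ℕ) : MeasurableSpace Ω :=
  ⨆ q ∈ {q : ℕ × Fin M × Fin K | t ≤ q.1},
    MeasurableSpace.comap (X q.1 q.2.1 q.2.2) inferInstance

lemma measurable_past (X : ℕ → Fin M → Fin K → Ω → ℝ) {s t : ℕ} (h : s < t) (i : Fin M)
    (k : Fin K) : Measurable[past X t] (X s i k) := by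
  refine Measurable.mono (comap_measurable (X s i k)) ?_ le_rfl
  exact le_biSup (fun q : ℕ × Fin M × Fin K =>
    MeasurableSpace.comap (X q.1 q.2.1 q.2.2) inferInstance) (i := (s, i, k)) h

lemma measurable_future (X : ℕ → Fin M → Fin K → Ω → ℝ) {s t : ℕ} (h : t ≤ s) (i : Fin M)
    (k : Fin K) : Measurable[future X t] (X s i k) := by
  refine Measurable.mono (comap_measurable (X s i k)) ?_ le_rfl
  exact le_biSup (fun q : ℕ × Fin M × Fin K =>
    MeasurableSpace.comap (X q.1 q.2.1 q.2.2) inferInstance) (i := (s, i, k)) h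

lemma past_mono (X : ℕ → Fin M → Fin K → Ω → ℝ) {s t : ℕ} (h : s ≤ t) : past X s ≤ past X t :=
  biSup_mono fun _ hq => lt_of_lt_of_le hq h

lemma past_le [mΩ : MeasurableSpace Ω] {X : ℕ → Fin M → Fin K → Ω → ℝ}
    (hX : ∀ t i k, Measurable (X t i k)) (t : ℕ) : past X t ≤ mΩ :=
  iSup₂_le fun _ _ => (hX _ _ _).comap_le

variable [NeZero K]

lemma measurable_estimate (X : ℕ → Fin M → Fin K → Ω → ℝ) (m : ℕ) (h : Holding M K) (t : ℕ) :
    Measurable[past X (t + phaseLength m h)]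
      (fun ω => estimate m h (fun t i k => X t i k ω) t) := by
  let _ := past X (t + phaseLength m h)
  refine measurable_pi_iff.2 fun a => ?_
  classical
  simp only [estimate_eq]
  refine Measurable.div_const (Finset.measurable_fun_sum _ fun q hq => ?_) _
  have hq' := (Finset.mem_filter.1 (show q ∈ Finset.filter _ _ from hq)).1
  simp only [Finset.mem_product, Finset.mem_range, Finset.mem_univ, and_true] at hq'
  exact measurable_past X (by omega) _ _

variable (T : ℕ) (realloc : ℕ → (Fin M → Finset (Fin K)) → (Fin M → Finset (Fin K)))
  (X : ℕ → Fin M → Fin K → Ω → ℝ) (ρ : Fin K → Fin M)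

/-- The stopping-time property of phase ends: the elapsed time is part of the state, so being in
state `s` is decided by rewards before `s.time`. There are countably many states, so the event
splits over the preceding one. -/
lemma measurableSet_past_run_eq (n : ℕ) (s : State M K) :
    MeasurableSet[past X s.time] {ω | run T realloc (fun t i k => X t i k ω) ρ n = s} := by
  induction n generalizing s with
  | zero =>
    simp only [run]
    exact @MeasurableSet.const Ω (past X s.time) _
  | succ n ih =>
    let h : State M K → Holding M K := fun s => prepare (realloc (n + 1)) s.holding
    let m := pullsPerArm M K T (n + 1)
    have : {ω | run T realloc (fun t i k => X t i k ω) ρ (n + 1) = s} =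
        ⋃ s₀ : State M K, {ω | run T realloc (fun t i k => X t i k ω) ρ n = s₀} ∩
          {ω | s₀.time + phaseLength m (h s₀) = s.time ∧ eliminate (n + 1)
            (estimate m (h s₀) (fun t i k => X t i k ω) s₀.time) (h s₀) = s.holding} := by
      ext ω
      simp only [Set.mem_ofPred_eq, Set.mem_iUnion, Set.mem_inter_iff]
      constructor
      · intro e
        refine ⟨_, rfl, ?_, ?_⟩
        · rw [← e]; rfl
        · rw [← e]; rfl
      · rintro ⟨s₀, rfl, e1, e2⟩
        cases s
        simp only at e1 e2
        subst e1 e2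
        rfl
    rw [this]
    refine @MeasurableSet.iUnion _ _ (past X s.time) _ _ fun s₀ => ?_
    by_cases hs : s₀.time + phaseLength m (h s₀) = s.time
    · refine @MeasurableSet.inter _ (past X s.time) _ _ (past_mono X (by omega) _ (ih s₀)) ?_
      simp only [hs, true_and]
      have h1 := measurable_estimate X m (h s₀) s₀.time
      rw [hs] at h1
      exact h1 (measurableSet_eliminate_eq (n + 1) (h s₀) s.holding)
    · simp only [hs, false_and]
      simp

variable [MeasurableSpace Ω]

variable {X} in
lemma measurableSet_run_eq (hX : ∀ t i k, Measurable (X t i k)) (n : ℕ) (s : State M K) :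
    MeasurableSet {ω | run T realloc (fun t i k => X t i k ω) ρ n = s} :=
  past_le hX _ _ (measurableSet_past_run_eq T realloc X ρ n s)

variable {X} in
lemma measurableSet_run_mem (hX : ∀ t i k, Measurable (X t i k)) (n : ℕ)
    (A : Set (State M K)) :
    MeasurableSet {ω | run T realloc (fun t i k => X t i k ω) ρ n ∈ A} := by
  have : {ω | run T realloc (fun t i k => X t i k ω) ρ n ∈ A} =
      ⋃ s ∈ A, {ω | run T realloc (fun t i k => X t i k ω) ρ n = s} := by
    ext ω; simp
  rw [this]
  exact MeasurableSet.biUnion (Set.to_countable _) fun s _ =>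
    measurableSet_run_eq T realloc ρ hX n s

variable {X} in
lemma measurable_phaseEstimate (hX : ∀ t i k, Measurable (X t i k)) (n : ℕ) :
    Measurable fun ω => phaseEstimate T realloc (fun t i k => X t i k ω) ρ n := by
  intro E hE
  have : (fun ω => phaseEstimate T realloc (fun t i k => X t i k ω) ρ n) ⁻¹' E =
      ⋃ s : State M K, {ω | run T realloc (fun t i k => X t i k ω) ρ n = s} ∩
        (fun ω => estimate (pullsPerArm M K T (n + 1)) (prepare (realloc (n + 1)) s.holding)
          (fun t i k => X t i k ω) s.time) ⁻¹' E := by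
    ext ω
    simp only [Set.mem_preimage, Set.mem_iUnion, Set.mem_inter_iff, Set.mem_ofPred_eq]
    constructor
    · intro h; exact ⟨_, rfl, h⟩
    · rintro ⟨s, rfl, h⟩; exact h
  rw [this]
  exact MeasurableSet.iUnion fun s => (measurableSet_run_eq T realloc ρ hX n s).inter
    (past_le hX _ _ (measurable_estimate X _ _ _ hE))

end Measurability

/-! ### The law of the estimates -/

/-- The joint law of the averages of `m` independent rewards of each arm. -/
noncomputable def averageLaw {K : ℕ} (P : Fin K → Measure ℝ) (m : ℕ) : Measure (Fin K → ℝ) :=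
  (Measure.pi fun q : Fin K × Fin m => P q.1).map fun y a => (∑ j, y (a, j)) / m

lemma measurable_average {K : ℕ} (m : ℕ) :
    Measurable fun (y : Fin K × Fin m → ℝ) (a : Fin K) => (∑ j, y (a, j)) / m := by
  fun_prop

instance {K : ℕ} (P : Fin K → Measure ℝ) [∀ k, IsProbabilityMeasure (P k)] (m : ℕ) :
    IsProbabilityMeasure (averageLaw P m) :=
  Measure.isProbabilityMeasure_map (measurable_average m).aemeasurable

/-- Replaces the state-dependent set of counted pulls by an enumeration by `Fin m`, as needed to
compare with `averageLaw`. -/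
lemma exists_enum_countedPulls {M K : ℕ} [NeZero M] [NeZero K] {m : ℕ} (hm : 0 < m)
    {h : Holding M K} (hh : h.Ready) :
    ∃ e : Fin K → Fin m → ℕ × Fin M, (∀ a, Function.Injective (e a)) ∧
      ∀ a ∈ h.arms, ∀ g : ℕ × Fin M → ℝ, ∑ q ∈ countedPulls m h a, g q = ∑ j, g (e a j) := by
  have : ∀ a, ∃ e : Fin m → ℕ × Fin M, Function.Injective e ∧
      (a ∈ h.arms → ∀ g : ℕ × Fin M → ℝ, ∑ q ∈ countedPulls m h a, g q = ∑ j, g (e j)) := by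
    intro a
    by_cases ha : a ∈ h.arms
    · let e := (Finset.equivFinOfCardEq (card_countedPulls hm hh ha)).symm
      refine ⟨fun j => (e j : ℕ × Fin M), Subtype.val_injective.comp e.injective, fun _ g => ?_⟩
      rw [← Finset.sum_coe_sort]
      exact (Equiv.sum_comp e fun q => g q).symm
    -- Eliminated arms get dummy sample positions, so that all `K` arms have `m` distinct samples;
    -- these values are never used.
    · exact ⟨fun j => (j, 0), fun j j' h => Fin.ext (by simpa using h), fun h => absurd h ha⟩
  choose e he using this
  exact ⟨e, fun a => (he a).1, fun a => (he a).2⟩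

section Law

variable {Ω : Type*} [MeasurableSpace Ω] {M K : ℕ} {P : Fin K → Measure ℝ}
  {X : ℕ → Fin M → Fin K → Ω → ℝ} {μ : Measure Ω} [IsProbabilityMeasure μ]
  (hX : ∀ t i k, Measurable (X t i k)) (hlaw : ∀ t i k, μ.map (X t i k) = P k)
  (hind : iIndepFun (fun q : ℕ × Fin M × Fin K => X q.1 q.2.1 q.2.2) μ)

omit [IsProbabilityMeasure μ] in
include hX in
lemma indep_past_future_of_iIndep (h : iIndep (fun q : ℕ × Fin M × Fin K =>
      MeasurableSpace.comap (X q.1 q.2.1 q.2.2) inferInstance) μ) (t : ℕ) :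
    Indep (past X t) (future X t) μ := by
  have hd : Disjoint {q : ℕ × Fin M × Fin K | q.1 < t} {q : ℕ × Fin M × Fin K | t ≤ q.1} :=
    Set.disjoint_left.2 fun q h1 h2 => absurd (Set.mem_ofPred.1 h1) (not_lt.2 (Set.mem_ofPred.1 h2))
  refine indep_iSup_of_disjoint (fun q => ?_) h hd
  exact (hX q.1 q.2.1 q.2.2).comap_le

omit [IsProbabilityMeasure μ] in
include hX hind in
lemma indep_past_future (t : ℕ) : Indep (past X t) (future X t) μ :=
  indep_past_future_of_iIndep hX ((iIndepFun_iff_iIndep (fun _ => inferInstance) _ μ).1 hind) t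

include hX hind

include hlaw

/-- Injectivity for each arm separately suffices, because the arm is itself part of the index of a
reward. -/
lemma map_samples_eq {m : ℕ} {e : Fin K → Fin m → ℕ × Fin M}
    (he : ∀ a, Function.Injective (e a)) (t : ℕ) :
    μ.map (fun ω (q : Fin K × Fin m) => X (t + (e q.1 q.2).1) (e q.1 q.2).2 q.1 ω) =
      Measure.pi fun q : Fin K × Fin m => P q.1 := by
  have h1 : iIndepFun (fun q : Fin K × Fin m => X (t + (e q.1 q.2).1) (e q.1 q.2).2 q.1) μ := by
    refine hind.precomp (g := fun q : Fin K × Fin m => (t + (e q.1 q.2).1, (e q.1 q.2).2, q.1)) ?_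
    rintro ⟨a, j⟩ ⟨a', j'⟩ h
    simp only [Prod.mk.injEq, Nat.add_left_cancel_iff] at h
    obtain ⟨h1, h2, rfl⟩ := h
    rw [he a (Prod.ext h1 h2)]
  rw [(iIndepFun_iff_map_fun_eq_pi_map fun q => (hX _ _ _).aemeasurable).1 h1]
  simp only [hlaw]

variable [NeZero M] [NeZero K] {T : ℕ}
  {realloc : ℕ → (Fin M → Finset (Fin K)) → (Fin M → Finset (Fin K))}
  (hr : IsReallocationRule realloc) (hT : 2 < T) (ρ : Fin K → Fin M)

include hr hT

/-- The Markov property. The state is decided by rewards before `s.time`, and the estimates of the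
next phase are averages of `m` distinct rewards per arm from then on. Only remaining arms have
genuine estimates, which is why `E` must depend on their coordinates alone. -/
lemma measure_run_eq_inter_phaseEstimate (n : ℕ) (s : State M K) {E : Set (Fin K → ℝ)}
    (hE : MeasurableSet E)
    (hEs : ∀ u v : Fin K → ℝ, (∀ a ∈ s.holding.arms, u a = v a) → (u ∈ E ↔ v ∈ E)) :
    μ ({ω | run T realloc (fun t i k => X t i k ω) ρ n = s} ∩
        {ω | phaseEstimate T realloc (fun t i k => X t i k ω) ρ n ∈ E}) =
      μ {ω | run T realloc (fun t i k => X t i k ω) ρ n = s} *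
        averageLaw P (pullsPerArm M K T (n + 1)) E := by
  set m := pullsPerArm M K T (n + 1) with hm
  -- Only states that are reached are known to be valid; for the others both sides vanish.
  by_cases hne : ∃ ω, run T realloc (fun t i k => X t i k ω) ρ n = s
  swap
  · have : {ω | run T realloc (fun t i k => X t i k ω) ρ n = s} = ∅ := by
      ext ω; simpa using fun h => hne ⟨ω, h⟩
    simp [this]
  obtain ⟨ω₀, hω₀⟩ := hne
  have hval : s.holding.Valid := hω₀ ▸ run_valid hr _ ρ n
  set h := prepare (realloc (n + 1)) s.holding with hh
  have hready : h.Ready := prepare_ready (hr _) hval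
  have harms : h.arms = s.holding.arms := arms_prepare (hr _) hval
  obtain ⟨e, he, hsum⟩ := exists_enum_countedPulls (pullsPerArm_pos (M := M) (K := K) hT (n + 1))
    hready
  set Y : Ω → Fin K × Fin m → ℝ :=
    fun ω q => X (s.time + (e q.1 q.2).1) (e q.1 q.2).2 q.1 ω with hY
  have hYm : Measurable[future X s.time] Y := by
    let _ := future X s.time
    exact measurable_pi_iff.2 fun q => measurable_future X (Nat.le_add_right _ _) _ _
  have hYm' : Measurable Y := measurable_pi_iff.2 fun q => hX _ _ _
  let E' : Set (Fin K × Fin m → ℝ) := (fun y a => (∑ j, y (a, j)) / m) ⁻¹' E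
  have hE' : MeasurableSet E' := measurable_average m hE
  have hset : {ω | run T realloc (fun t i k => X t i k ω) ρ n = s} ∩
        {ω | phaseEstimate T realloc (fun t i k => X t i k ω) ρ n ∈ E} =
      {ω | run T realloc (fun t i k => X t i k ω) ρ n = s} ∩ Y ⁻¹' E' := by
    ext ω
    refine and_congr_right fun hω => ?_
    have hω' : run T realloc (fun t i k => X t i k ω) ρ n = s := hω
    refine hEs _ _ fun a ha => ?_
    rw [phaseEstimate, phaseHolding, hω', estimate_eq]
    rw [hsum a (by rw [harms]; exact ha) fun q => X (s.time + q.1) q.2 a ω]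
  rw [hset, (Indep_iff _ _ μ).1 (indep_past_future hX hind s.time) _ _
    (measurableSet_past_run_eq T realloc X ρ n s) (hYm hE'),
    averageLaw, Measure.map_apply (measurable_average m) hE,
    ← map_samples_eq hX hlaw hind he s.time, Measure.map_apply hYm' hE']

lemma measure_arms_eq_inter_phaseEstimate (n : ℕ) (S : Finset (Fin K)) {E : Set (Fin K → ℝ)}
    (hE : MeasurableSet E)
    (hES : ∀ u v : Fin K → ℝ, (∀ a ∈ S, u a = v a) → (u ∈ E ↔ v ∈ E)) :
    μ ({ω | (run T realloc (fun t i k => X t i k ω) ρ n).holding.arms = S} ∩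
        {ω | phaseEstimate T realloc (fun t i k => X t i k ω) ρ n ∈ E}) =
      μ {ω | (run T realloc (fun t i k => X t i k ω) ρ n).holding.arms = S} *
        averageLaw P (pullsPerArm M K T (n + 1)) E := by
  have h1 : {ω | (run T realloc (fun t i k => X t i k ω) ρ n).holding.arms = S} =
      ⋃ s : {s : State M K // s.holding.arms = S},
        {ω | run T realloc (fun t i k => X t i k ω) ρ n = s} := by
    ext ω; simp
  have hdisj : Pairwise fun s s' : {s : State M K // s.holding.arms = S} =>
      Disjoint {ω | run T realloc (fun t i k => X t i k ω) ρ n = s}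
        {ω | run T realloc (fun t i k => X t i k ω) ρ n = s'} := by
    intro s s' hss
    refine Set.disjoint_left.2 fun ω h h' => hss (Subtype.ext ?_)
    exact Eq.trans (Eq.symm h) h'
  have hEm : MeasurableSet {ω | phaseEstimate T realloc (fun t i k => X t i k ω) ρ n ∈ E} :=
    measurable_phaseEstimate T realloc ρ hX n hE
  rw [h1, Set.iUnion_inter, measure_iUnion, measure_iUnion hdisj, ← ENNReal.tsum_mul_right]
  · refine tsum_congr fun s => ?_
    exact measure_run_eq_inter_phaseEstimate hX hlaw hind hr hT ρ n s hE
      (fun u v h => hES u v (by rwa [s.2] at h))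
  · exact fun s => measurableSet_run_eq T realloc ρ hX n s
  · exact fun s s' hss => (hdisj hss).mono Set.inter_subset_left Set.inter_subset_left
  · exact fun s => (measurableSet_run_eq T realloc ρ hX n s).inter hEm

end Law

/-- The law of the set of remaining arms after `n` phases, which does not depend on how the arms
are distributed among the agents. -/
noncomputable def armsLaw {K : ℕ} (P : Fin K → Measure ℝ) (M T : ℕ) : ℕ → Finset (Fin K) → ℝ≥0∞
  | 0, S => if S = Finset.univ then 1 else 0
  | n + 1, S' => ∑ S, armsLaw P M T n S *
      averageLaw P (pullsPerArm M K T (n + 1)) {u | survivors (n + 1) u S = S'}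

section Law

variable {Ω : Type*} [MeasurableSpace Ω] {M K : ℕ} {P : Fin K → Measure ℝ}
  {X : ℕ → Fin M → Fin K → Ω → ℝ} {μ : Measure Ω} [IsProbabilityMeasure μ]
  (hX : ∀ t i k, Measurable (X t i k)) (hlaw : ∀ t i k, μ.map (X t i k) = P k)
  (hind : iIndepFun (fun q : ℕ × Fin M × Fin K => X q.1 q.2.1 q.2.2) μ)
  [NeZero M] [NeZero K] {T : ℕ}
  {realloc : ℕ → (Fin M → Finset (Fin K)) → (Fin M → Finset (Fin K))}
  (ρ : Fin K → Fin M)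

include hX

omit [NeZero M] in
lemma measurableSet_arms_eq (n : ℕ) (S : Finset (Fin K)) :
    MeasurableSet {ω | (run T realloc (fun t i k => X t i k ω) ρ n).holding.arms = S} :=
  measurableSet_run_mem T realloc ρ hX n {s | s.holding.arms = S}

omit [NeZero M] [IsProbabilityMeasure μ] in
lemma sum_measure_arms_inter (n : ℕ) {A : Set Ω} (hA : MeasurableSet A) :
    ∑ S, μ ({ω | (run T realloc (fun t i k => X t i k ω) ρ n).holding.arms = S} ∩ A) = μ A := by
  rw [← measure_biUnion_finset]
  · congr 1
    ext ω
    simp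
  · intro S _ S' _ hSS
    refine Set.disjoint_left.2 fun ω h h' => hSS ?_
    exact h.1.symm.trans h'.1
  · exact fun S _ => (measurableSet_arms_eq hX ρ n S).inter hA

variable (hr : IsReallocationRule realloc) (hT : 2 < T)

include hlaw hind hr hT

/-- By the Markov property the transition from one remaining set to the next involves only
`averageLaw`. The right side is therefore free of `ρ`, although the execution is not. -/
lemma measure_arms_eq (n : ℕ) (S : Finset (Fin K)) :
    μ {ω | (run T realloc (fun t i k => X t i k ω) ρ n).holding.arms = S} =
      armsLaw P M T n S := by
  induction n generalizing S with
  | zero =>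
    have : ∀ ω, (run T realloc (fun t i k => X t i k ω) ρ 0).holding.arms = Finset.univ := by
      intro ω; ext k; simp [run, Holding.arms]
    simp only [this, armsLaw]
    split_ifs with h
    · simp [h]
    · simp [Ne.symm h]
  | succ n ih =>
    rw [← sum_measure_arms_inter (T := T) (realloc := realloc) hX ρ n
      (measurableSet_arms_eq hX ρ (n + 1) S), armsLaw]
    refine Finset.sum_congr rfl fun S₀ _ => ?_
    rw [← ih, ← measure_arms_eq_inter_phaseEstimate hX hlaw hind hr hT ρ n S₀
      (measurableSet_survivors_eq (n + 1) S₀ S)]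
    · congr 1
      ext ω
      refine and_congr_right fun h => ?_
      have h' : (run T realloc (fun t i k => X t i k ω) ρ n).holding.arms = S₀ := h
      simp only [Set.mem_ofPred_eq]
      rw [arms_run_succ hr, h']
    · intro u v huv
      simp only [Set.mem_ofPred_eq]
      rw [survivors_congr _ huv]

lemma sum_armsLaw (n : ℕ) : ∑ S, armsLaw P M T n S = 1 := by
  have := sum_measure_arms_inter (μ := μ) (T := T) (realloc := realloc) hX (fun _ => 0) n
    MeasurableSet.univ
  simp only [Set.inter_univ, measure_univ] at this
  rw [← this]
  exact Finset.sum_congr rfl fun S _ => (measure_arms_eq hX hlaw hind (fun _ => 0) hr hT n S).symm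

end Law

/-! ### Accuracy of the estimates -/

section Hoeffding

variable {K : ℕ} (P : Fin K → Measure ℝ) [∀ k, IsProbabilityMeasure (P k)]
  (hP : ∀ k, ∀ᵐ y ∂(P k), y ∈ Set.Icc (0 : ℝ) 1)

include hP

/-- Hoeffding's inequality; the sign `c` serves both tails. Each summand has variance proxy `1 / 4`.
-/
lemma measure_pi_sum_ge_le (m : ℕ) (a : Fin K) {c : ℝ} (hc : c = 1 ∨ c = -1) {ε : ℝ} (hε : 0 ≤ ε) :
    (Measure.pi fun q : Fin K × Fin m => P q.1).real
      {y | ε ≤ ∑ j, c * (y (a, j) - mean P a)} ≤ Real.exp (-ε ^ 2 / (m / 2)) := by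
  set ν := Measure.pi fun q : Fin K × Fin m => P q.1 with hν
  have hind : iIndepFun (fun (j : Fin m) (y : Fin K × Fin m → ℝ) => c * (y (a, j) - mean P a)) ν :=
    (iIndepFun_pi (μ := fun q : Fin K × Fin m => P q.1) (X := fun q z => c * (z - mean P a))
      (fun q => by fun_prop)).precomp (g := fun j => (a, j)) fun j j' h => by simpa using h
  have hsub : ∀ j ∈ (Finset.univ : Finset (Fin m)), HasSubgaussianMGF
      (fun y : Fin K × Fin m → ℝ => c * (y (a, j) - mean P a)) ((‖(1 : ℝ) - 0‖₊ / 2) ^ 2) ν := by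
    intro j _
    have hpres := measurePreserving_eval (fun q : Fin K × Fin m => P q.1) (a, j)
    have h1 : ∀ᵐ y ∂ν, y (a, j) ∈ Set.Icc (0 : ℝ) 1 := hpres.quasiMeasurePreserving.ae (hP a)
    have h2 : ∫ y, y (a, j) ∂ν = mean P a := by
      rw [mean, ← hpres.map_eq, integral_map hpres.measurable.aemeasurable (by fun_prop)]
    have h3 := hasSubgaussianMGF_of_mem_Icc (μ := ν) (X := fun y => y (a, j))
      (measurable_pi_apply _).aemeasurable h1
    rw [h2] at h3
    rcases hc with rfl | rfl
    · simpa using h3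
    · have h4 := h3.neg
      refine h4.congr (Filter.Eventually.of_forall fun y => ?_)
      simp
  refine (HasSubgaussianMGF.measure_sum_ge_le_of_iIndepFun hind hsub hε).trans (le_of_eq ?_)
  congr 2
  simp
  ring

lemma averageLaw_abs_sub_le {m : ℕ} (hm : 0 < m) (a : Fin K) {ε : ℝ} (hε : 0 ≤ ε) :
    averageLaw P m {u | ε < |u a - mean P a|} ≤
      ENNReal.ofReal (2 * Real.exp (-2 * m * ε ^ 2)) := by
  have hm' : (0 : ℝ) < m := by exact_mod_cast hm
  have hmeas : MeasurableSet {u : Fin K → ℝ | ε < |u a - mean P a|} :=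
    measurableSet_lt measurable_const ((measurable_pi_apply a).sub_const _).abs
  rw [averageLaw, Measure.map_apply (measurable_average m) hmeas]
  set ν := Measure.pi fun q : Fin K × Fin m => P q.1 with hν
  have hsub : (fun (y : Fin K × Fin m → ℝ) (a : Fin K) => (∑ j, y (a, j)) / (m : ℝ)) ⁻¹'
      {u | ε < |u a - mean P a|} ⊆
      {y | m * ε ≤ ∑ j, 1 * (y (a, j) - mean P a)} ∪
        {y | m * ε ≤ ∑ j, -1 * (y (a, j) - mean P a)} := by
    intro y hy
    have hy' : ε < |(∑ j, y (a, j)) / (m : ℝ) - mean P a| := hy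
    have e : (∑ j, y (a, j)) / (m : ℝ) - mean P a = (∑ j, (y (a, j) - mean P a)) / m := by
      rw [Finset.sum_sub_distrib]
      simp
      field_simp
    rw [e] at hy'
    simp only [Set.mem_union, Set.mem_ofPred_eq, ← Finset.mul_sum]
    rcases lt_abs.1 hy' with h | h
    · left
      rw [lt_div_iff₀ hm'] at h
      linarith
    · right
      rw [← neg_div, lt_div_iff₀ hm'] at h
      linarith
  have hexp : ∀ c : ℝ, c = 1 ∨ c = -1 → ν {y | m * ε ≤ ∑ j, c * (y (a, j) - mean P a)} ≤
      ENNReal.ofReal (Real.exp (-2 * m * ε ^ 2)) := by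
    intro c hc
    rw [← ofReal_measureReal]
    refine ENNReal.ofReal_le_ofReal ?_
    refine (measure_pi_sum_ge_le P hP m a hc (by positivity)).trans (le_of_eq ?_)
    congr 1
    field_simp
  refine (measure_mono hsub).trans ((measure_union_le _ _).trans
    ((add_le_add (hexp 1 (Or.inl rfl)) (hexp (-1) (Or.inr rfl))).trans (le_of_eq ?_)))
  rw [← ENNReal.ofReal_add (Real.exp_nonneg _) (Real.exp_nonneg _)]
  congr 1
  ring

lemma averageLaw_phase_abs_sub_le {M T : ℕ} [NeZero M] [NeZero K] (hT : 2 < T) (n : ℕ)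
    (a : Fin K) :
    averageLaw P (pullsPerArm M K T (n + 1)) {u | (1 / 2) ^ (n + 2) < |u a - mean P a|} ≤
      ENNReal.ofReal (2 * ((M : ℝ) * K * T)⁻¹ ^ 3) := by
  have hM : (0 : ℝ) < M := by exact_mod_cast NeZero.pos M
  have hK : (0 : ℝ) < K := by exact_mod_cast NeZero.pos K
  have hT' : (0 : ℝ) < T := by exact_mod_cast (by omega : 0 < T)
  refine (averageLaw_abs_sub_le P hP (pullsPerArm_pos hT _) a (by positivity)).trans
    (ENNReal.ofReal_le_ofReal ?_)
  have hL := log_horizon_pos (M := M) (K := K) hT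
  have hm := le_pullsPerArm M K T (n + 1)
  set L := Real.log ((M : ℝ) * K * T) with hLdef
  have h1 : ((M : ℝ) * K * T)⁻¹ ^ 3 = Real.exp (-(3 * L)) := by
    rw [Real.exp_neg, show (3 : ℝ) * L = ((3 : ℕ) : ℝ) * L by norm_num, Real.exp_nat_mul,
      Real.exp_log (by positivity), inv_pow]
  rw [h1]
  have h2 : ((1 / 2 : ℝ) ^ (n + 2)) ^ 2 * 4 ^ (n + 1 + 3) = 16 := by
    rw [← pow_mul, mul_comm (n + 2) 2, pow_mul, show n + 1 + 3 = (n + 2) + 2 by ring, pow_add 4,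
      ← mul_assoc, ← mul_pow]
    norm_num
  -- The accuracy is `ε = 2^(-(n+2))` and `m ≥ 4^(n+4) L`, so `2 m ε^2 ≥ 32 L`; a third of
  -- `MKT`-powers as small as `3 L` already suffices.
  have h3 : 32 * L ≤ 2 * (pullsPerArm M K T (n + 1) : ℝ) * ((1 / 2 : ℝ) ^ (n + 2)) ^ 2 := by
    calc 32 * L = 2 * (((1 / 2 : ℝ) ^ (n + 2)) ^ 2 * 4 ^ (n + 1 + 3)) * L := by rw [h2]; ring
      _ = 2 * (4 ^ (n + 1 + 3) * L) * ((1 / 2 : ℝ) ^ (n + 2)) ^ 2 := by ring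
      _ ≤ _ := by gcongr
  refine mul_le_mul_of_nonneg_left (Real.exp_le_exp.2 ?_) zero_le_two
  linarith

end Hoeffding

section Accuracy

variable {Ω : Type*} [MeasurableSpace Ω] {M K : ℕ} {P : Fin K → Measure ℝ}
  {X : ℕ → Fin M → Fin K → Ω → ℝ} {μ : Measure Ω} [IsProbabilityMeasure μ]
  (hX : ∀ t i k, Measurable (X t i k)) [NeZero M] [NeZero K] {T : ℕ}
  {realloc : ℕ → (Fin M → Finset (Fin K)) → (Fin M → Finset (Fin K))}
  (ρ : Fin K → Fin M)

include hX

omit [NeZero M] in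
lemma measurableSet_accurate :
    MeasurableSet {ω | Accurate P T realloc (fun t i k => X t i k ω) ρ} := by
  simp only [Accurate]
  refine measurableSet_setOfPred.2 ?_
  refine Measurable.forall fun n => Measurable.imp measurable_const ?_
  refine Measurable.forall fun a => Measurable.imp ?_ ?_
  · exact measurableSet_setOfPred.1
      (measurableSet_run_mem T realloc ρ hX n {s | a ∈ s.holding.arms})
  · refine measurableSet_setOfPred.1 (measurableSet_le ?_ measurable_const)
    exact ((measurable_pi_iff.1 (measurable_phaseEstimate T realloc ρ hX n) a).sub_const _).abs

variable [∀ k, IsProbabilityMeasure (P k)] (hP : ∀ k, ∀ᵐ y ∂(P k), y ∈ Set.Icc (0 : ℝ) 1)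
  (hlaw : ∀ t i k, μ.map (X t i k) = P k)
  (hind : iIndepFun (fun q : ℕ × Fin M × Fin K => X q.1 q.2.1 q.2.2) μ)
  (hr : IsReallocationRule realloc) (hT : 2 < T)

include hP hlaw hind hr hT

/-- Conditioning on the remaining set `S`, each phase fails with probability at most `K η`; the
weights of the sets `S` add up to `1`, so there is no loss from their number. -/
lemma measure_not_accurate_le :
    μ {ω | ¬ Accurate P T realloc (fun t i k => X t i k ω) ρ} ≤
      T * K * ENNReal.ofReal (2 * ((M : ℝ) * K * T)⁻¹ ^ 3) := by
  set η := ENNReal.ofReal (2 * ((M : ℝ) * K * T)⁻¹ ^ 3)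
  let E : ℕ → Finset (Fin K) → Set (Fin K → ℝ) := fun n S =>
    ⋃ a ∈ S, {u | (1 / 2) ^ (n + 2) < |u a - mean P a|}
  have hE : ∀ n S, MeasurableSet (E n S) := fun n S =>
    S.measurableSet_biUnion fun a _ =>
      measurableSet_lt measurable_const ((measurable_pi_apply a).sub_const _).abs
  have hEη : ∀ n S, averageLaw P (pullsPerArm M K T (n + 1)) (E n S) ≤ K * η := by
    intro n S
    refine (measure_biUnion_finset_le _ _).trans ?_
    refine (Finset.sum_le_sum fun a _ => averageLaw_phase_abs_sub_le P hP hT n a).trans ?_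
    rw [Finset.sum_const, nsmul_eq_mul]
    gcongr
    simpa using Finset.card_le_univ S
  have hsub : {ω | ¬ Accurate P T realloc (fun t i k => X t i k ω) ρ} ⊆
      ⋃ n ∈ Finset.range T, ⋃ S ∈ (Finset.univ : Finset (Finset (Fin K))),
        ({ω | (run T realloc (fun t i k => X t i k ω) ρ n).holding.arms = S} ∩
          {ω | phaseEstimate T realloc (fun t i k => X t i k ω) ρ n ∈ E n S}) := by
    intro ω hω
    simp only [Accurate, Set.mem_ofPred_eq, not_forall, not_le] at hω
    obtain ⟨n, hn, a, ha, h⟩ := hω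
    simp only [Set.mem_iUnion, Finset.mem_range, Finset.mem_univ, Set.mem_inter_iff,
      Set.mem_ofPred_eq, E]
    exact ⟨n, hn, _, trivial, rfl, a, ha, h⟩
  refine (measure_mono hsub).trans ((measure_biUnion_finset_le _ _).trans ?_)
  have hn : ∀ n ∈ Finset.range T, μ (⋃ S ∈ (Finset.univ : Finset (Finset (Fin K))),
        ({ω | (run T realloc (fun t i k => X t i k ω) ρ n).holding.arms = S} ∩
          {ω | phaseEstimate T realloc (fun t i k => X t i k ω) ρ n ∈ E n S})) ≤ K * η := by
    intro n _
    refine (measure_biUnion_finset_le _ _).trans ?_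
    calc ∑ S, μ ({ω | (run T realloc (fun t i k => X t i k ω) ρ n).holding.arms = S} ∩
          {ω | phaseEstimate T realloc (fun t i k => X t i k ω) ρ n ∈ E n S})
        = ∑ S, μ {ω | (run T realloc (fun t i k => X t i k ω) ρ n).holding.arms = S} *
            averageLaw P (pullsPerArm M K T (n + 1)) (E n S) := by
          refine Finset.sum_congr rfl fun S _ => ?_
          refine measure_arms_eq_inter_phaseEstimate hX hlaw hind hr hT ρ n S (hE n S) ?_
          intro u v huv
          simp only [E, Set.mem_iUnion, Set.mem_ofPred_eq]
          exact exists_congr fun a => exists_congr fun ha => by rw [huv a ha]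
      _ ≤ ∑ S, μ {ω | (run T realloc (fun t i k => X t i k ω) ρ n).holding.arms = S} * (K * η) := by
          gcongr; exact hEη _ _
      _ = K * η := by
          rw [← Finset.sum_mul]
          simp only [measure_arms_eq hX hlaw hind ρ hr hT, sum_armsLaw hX hlaw hind hr hT, one_mul]
  refine (Finset.sum_le_sum hn).trans (le_of_eq ?_)
  simp [mul_assoc]

end Accuracy

/-! ### Balance of the random allocation -/

section Allocation

variable {Ω : Type*} [MeasurableSpace Ω] {M K : ℕ} {μ : Measure Ω} [IsProbabilityMeasure μ]
  {r : Fin K → Ω → Fin M}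

/-- The indicator of the event that arm `k` is allocated to agent `i`. -/
noncomputable def allocIndicator (r : Fin K → Ω → Fin M) (i : Fin M) (k : Fin K) (ω : Ω) : ℝ :=
  if r k ω = i then 1 else 0

lemma measurable_allocIndicator (hr : ∀ k, Measurable (r k)) (i : Fin M) (k : Fin K) :
    Measurable (allocIndicator r i k) :=
  (Measurable.of_discrete (f := fun z : Fin M => if z = i then (1 : ℝ) else 0)).comp (hr k)

omit [MeasurableSpace Ω] in
lemma card_split_eq (i : Fin M) (S : Finset (Fin K)) (ω : Ω) :
    ((split (fun k => r k ω) S i).card : ℝ) = (∑ k ∈ S, allocIndicator r i k) ω := by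
  simp [split, allocIndicator, Finset.sum_apply]

/-- From `exp t - 1 ≤ t + t ^ 2` for `|t| ≤ 1` and `1 + y ≤ exp y`. -/
lemma mgf_allocIndicator_le [NeZero M] (hr : ∀ k, Measurable (r k))
    (hu : ∀ k i, μ {ω | r k ω = i} = (M : ℝ≥0∞)⁻¹) (i : Fin M) (k : Fin K) {t : ℝ}
    (ht : |t| ≤ 1) : mgf (allocIndicator r i k) μ t ≤ Real.exp ((t + t ^ 2) / M) := by
  have hM : (0 : ℝ) < M := by exact_mod_cast NeZero.pos M
  have hms : MeasurableSet {ω | r k ω = i} := hr k (measurableSet_singleton i)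
  have h1 : (fun ω => Real.exp (t * allocIndicator r i k ω)) =
      fun ω => 1 + (Real.exp t - 1) * ({ω | r k ω = i}.indicator (1 : Ω → ℝ)) ω := by
    funext ω
    by_cases h : r k ω = i <;> simp [allocIndicator, h]
  have h2 : ∫ ω, ({ω | r k ω = i}.indicator (1 : Ω → ℝ)) ω ∂μ = (M : ℝ)⁻¹ := by
    rw [integral_indicator_one hms, measureReal_def, hu]
    simp
  have h3 : Integrable ({ω | r k ω = i}.indicator (1 : Ω → ℝ)) μ :=
    (integrable_const (1 : ℝ)).indicator hms
  have h4 : mgf (allocIndicator r i k) μ t = 1 + (Real.exp t - 1) * (M : ℝ)⁻¹ := by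
    rw [mgf, h1, integral_add (integrable_const _) (h3.const_mul _), integral_const_mul, h2]
    simp
  have h5 : Real.exp t - 1 ≤ t + t ^ 2 := by
    have := (abs_le.1 (Real.abs_exp_sub_one_sub_id_le ht)).2
    linarith
  rw [h4]
  calc 1 + (Real.exp t - 1) * (M : ℝ)⁻¹ ≤ 1 + (t + t ^ 2) * (M : ℝ)⁻¹ := by gcongr
    _ = (t + t ^ 2) / M + 1 := by ring
    _ ≤ _ := Real.add_one_le_exp _

lemma mgf_sum_allocIndicator_le [NeZero M] (hr : ∀ k, Measurable (r k))
    (hu : ∀ k i, μ {ω | r k ω = i} = (M : ℝ≥0∞)⁻¹) (hind : iIndepFun r μ) (i : Fin M)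
    (S : Finset (Fin K)) {t : ℝ} (ht : |t| ≤ 1) :
    mgf (∑ k ∈ S, allocIndicator r i k) μ t ≤ Real.exp (S.card * ((t + t ^ 2) / M)) := by
  have h : iIndepFun (allocIndicator r i) μ :=
    hind.comp (fun _ (z : Fin M) => if z = i then (1 : ℝ) else 0) fun _ => Measurable.of_discrete
  rw [h.mgf_sum (measurable_allocIndicator hr i), Real.exp_nat_mul]
  refine (Finset.prod_le_prod (fun _ _ => mgf_nonneg)
    fun k _ => mgf_allocIndicator_le hr hu i k ht).trans_eq ?_
  rw [Finset.prod_const]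

lemma integrable_exp_sum_allocIndicator (hr : ∀ k, Measurable (r k)) (i : Fin M)
    (S : Finset (Fin K)) (t : ℝ) :
    Integrable (fun ω => Real.exp (t * (∑ k ∈ S, allocIndicator r i k) ω)) μ := by
  have hm : Measurable (∑ k ∈ S, allocIndicator r i k) := by
    rw [show ∑ k ∈ S, allocIndicator r i k = fun ω => ∑ k ∈ S, allocIndicator r i k ω from
      funext fun ω => Finset.sum_apply _ _ _]
    exact Finset.measurable_sum _ fun k _ => measurable_allocIndicator hr i k
  refine Integrable.of_bound (C := Real.exp (|t| * K)) (by fun_prop)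
    (Filter.Eventually.of_forall fun ω => ?_)
  rw [← card_split_eq, Real.norm_eq_abs, Real.abs_exp]
  refine Real.exp_le_exp.2 ?_
  calc t * ((split (fun k => r k ω) S i).card : ℝ) ≤ |t| * ((split (fun k => r k ω) S i).card : ℝ) :=
        mul_le_mul_of_nonneg_right (le_abs_self t) (Nat.cast_nonneg _)
    _ ≤ |t| * K := by
        refine mul_le_mul_of_nonneg_left ?_ (abs_nonneg t)
        exact_mod_cast (Finset.card_le_univ _).trans_eq (Fintype.card_fin K)

lemma balanced_of_card_near {B : Fin M → Finset (Fin K)} {x : ℝ}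
    (h : ∀ i, 2 / 3 * x < (B i).card ∧ ((B i).card : ℝ) < 4 / 3 * x) : Balanced B := by
  intro i j
  have h1 := (h i).2
  have h2 := (h j).1
  have h3 : ((B i).card : ℝ) ≤ 2 * (B j).card := by linarith
  exact_mod_cast h3

/-- A Chernoff bound for each agent: its size has mean `x = |S| / M`, and staying strictly between
`2 / 3` and `4 / 3` of `x` gives balance, as the ratio of the two factors is `2`. -/
lemma measure_not_balanced_split_le [NeZero M] (hr : ∀ k, Measurable (r k))
    (hu : ∀ k i, μ {ω | r k ω = i} = (M : ℝ≥0∞)⁻¹) (hind : iIndepFun r μ) (S : Finset (Fin K)) :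
    μ {ω | ¬ Balanced (split (fun k => r k ω) S)} ≤
      M * ENNReal.ofReal (2 * Real.exp (-(S.card / (36 * M)))) := by
  have hM : (0 : ℝ) < M := by exact_mod_cast NeZero.pos M
  set x : ℝ := S.card / M with hx
  have hN : (S.card : ℝ) = x * M := by rw [hx]; field_simp
  let Z : Fin M → Ω → ℝ := fun i => ∑ k ∈ S, allocIndicator r i k
  have hsub : {ω | ¬ Balanced (split (fun k => r k ω) S)} ⊆
      ⋃ i ∈ (Finset.univ : Finset (Fin M)),
        ({ω | Z i ω ≤ 2 / 3 * x} ∪ {ω | 4 / 3 * x ≤ Z i ω}) := by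
    intro ω hω
    by_contra hc
    refine hω (balanced_of_card_near (x := x) fun i => ?_)
    simp only [Set.mem_iUnion, Finset.mem_univ, Set.mem_union, Set.mem_ofPred_eq, not_exists,
      not_or, not_le] at hc
    rw [card_split_eq]
    exact hc i trivial
  refine (measure_mono hsub).trans ((measure_biUnion_finset_le _ _).trans ?_)
  have hi : ∀ i ∈ (Finset.univ : Finset (Fin M)),
      μ ({ω | Z i ω ≤ 2 / 3 * x} ∪ {ω | 4 / 3 * x ≤ Z i ω}) ≤
        ENNReal.ofReal (2 * Real.exp (-(S.card / (36 * M)))) := by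
    intro i _
    refine (measure_union_le _ _).trans ?_
    rw [two_mul, ENNReal.ofReal_add (Real.exp_nonneg _) (Real.exp_nonneg _)]
    refine add_le_add ?_ ?_
    · rw [← ofReal_measureReal]
      refine ENNReal.ofReal_le_ofReal ?_
      -- The choice `|t| = 1 / 6` minimizes the exponent in both tails and makes it `-x / 36`.
      refine (measure_le_le_exp_mul_mgf (t := -(1 / 6)) _ (by norm_num)
        (integrable_exp_sum_allocIndicator hr i S _)).trans ?_
      refine (mul_le_mul_of_nonneg_left (mgf_sum_allocIndicator_le hr hu hind i S
        (by rw [abs_le]; norm_num)) (Real.exp_nonneg _)).trans (le_of_eq ?_)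
      rw [← Real.exp_add, hN]
      congr 1
      field_simp
      ring
    · rw [← ofReal_measureReal]
      refine ENNReal.ofReal_le_ofReal ?_
      refine (measure_ge_le_exp_mul_mgf (t := 1 / 6) _ (by norm_num)
        (integrable_exp_sum_allocIndicator hr i S _)).trans ?_
      refine (mul_le_mul_of_nonneg_left (mgf_sum_allocIndicator_le hr hu hind i S
        (by rw [abs_le]; norm_num)) (Real.exp_nonneg _)).trans (le_of_eq ?_)
      rw [← Real.exp_add, hN]
      congr 1
      field_simp
      ring
  refine (Finset.sum_le_sum hi).trans (le_of_eq ?_)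
  simp

end Allocation

/-! ### Rewards and allocation together -/

section Environment

variable {Ω : Type*} [MeasurableSpace Ω] {M K : ℕ} {P : Fin K → Measure ℝ}
  {X : ℕ → Fin M → Fin K → Ω → ℝ} {r : Fin K → Ω → Fin M} {μ : Measure Ω}
  [IsProbabilityMeasure μ]

namespace IsEnvironment

variable (he : IsEnvironment P X r μ)

include he

omit [IsProbabilityMeasure μ] in
lemma measurableSet_alloc_eq (ρ : Fin K → Fin M) : MeasurableSet {ω | (fun k => r k ω) = ρ} :=
  measurable_pi_iff.2 he.measurable_alloc (measurableSet_singleton ρ)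

omit [IsProbabilityMeasure μ] in
lemma sum_measure_alloc_inter (A : Set Ω) :
    ∑ ρ, μ ({ω | (fun k => r k ω) = ρ} ∩ A) = μ A := by
  have h := sum_measure_preimage_singleton (μ := μ.restrict A) (f := fun ω k => r k ω) Finset.univ
    fun ρ _ => he.measurableSet_alloc_eq ρ
  simp only [Finset.coe_univ, Set.preimage_univ, Measure.restrict_apply MeasurableSet.univ,
    Set.univ_inter] at h
  rw [← h]
  exact Finset.sum_congr rfl fun ρ _ => (Measure.restrict_apply (he.measurableSet_alloc_eq ρ)).symm

lemma sum_measure_alloc : ∑ ρ, μ {ω | (fun k => r k ω) = ρ} = 1 := by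
  simpa using he.sum_measure_alloc_inter Set.univ

omit [IsProbabilityMeasure μ] in
lemma measure_alloc_inter (ρ : Fin K → Fin M) {B : Set (ℕ × Fin M × Fin K → ℝ)}
    (hB : MeasurableSet B) :
    μ ({ω | (fun k => r k ω) = ρ} ∩ {ω | (fun q => X q.1 q.2.1 q.2.2 ω) ∈ B}) =
      μ {ω | (fun k => r k ω) = ρ} * μ {ω | (fun q => X q.1 q.2.1 q.2.2 ω) ∈ B} := by
  have h := he.indep_reward_alloc.measure_inter_preimage_eq_mul B {ρ} hB
    (measurableSet_singleton ρ)
  rw [Set.inter_comm, mul_comm]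
  exact h

variable [NeZero M] [NeZero K] {T : ℕ}
  {realloc : ℕ → (Fin M → Finset (Fin K)) → (Fin M → Finset (Fin K))}

lemma measure_not_accurate_le [∀ k, IsProbabilityMeasure (P k)]
    (hP : ∀ k, ∀ᵐ y ∂(P k), y ∈ Set.Icc (0 : ℝ) 1) (hr : IsReallocationRule realloc)
    (hT : 2 < T) :
    μ {ω | ¬ Accurate P T realloc (fun t i k => X t i k ω) (fun k => r k ω)} ≤
      T * K * ENNReal.ofReal (2 * ((M : ℝ) * K * T)⁻¹ ^ 3) := by
  rw [← he.sum_measure_alloc_inter]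
  calc ∑ ρ, μ ({ω | (fun k => r k ω) = ρ} ∩
        {ω | ¬ Accurate P T realloc (fun t i k => X t i k ω) (fun k => r k ω)})
      = ∑ ρ, μ {ω | (fun k => r k ω) = ρ} *
          μ {ω | ¬ Accurate P T realloc (fun t i k => X t i k ω) ρ} := by
        refine Finset.sum_congr rfl fun ρ _ => ?_
        -- Independence from the allocation needs the event as a measurable set of reward tables, so
        -- measurability is applied to the coordinate maps on the space of tables.
        have hB : MeasurableSet {x : ℕ × Fin M × Fin K → ℝ |
            ¬ Accurate P T realloc (fun t i k => x (t, i, k)) ρ} :=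
          (measurableSet_accurate (X := fun t i k (x : ℕ × Fin M × Fin K → ℝ) => x (t, i, k))
            (fun t i k => measurable_pi_apply _) ρ).compl
        refine Eq.trans ?_ (he.measure_alloc_inter ρ hB)
        congr 1
        ext ω
        refine and_congr_right fun h => ?_
        have h' : (fun k => r k ω) = ρ := h
        simp only [Set.mem_ofPred_eq]
        rw [h']
    _ ≤ ∑ ρ, μ {ω | (fun k => r k ω) = ρ} *
          (T * K * ENNReal.ofReal (2 * ((M : ℝ) * K * T)⁻¹ ^ 3)) := by
        gcongr with ρ
        exact DEMAB.measure_not_accurate_le he.measurable_reward ρ hP he.law_reward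
          he.indep_reward hr hT
    _ = _ := by rw [← Finset.sum_mul, he.sum_measure_alloc, one_mul]

/-- Here the independence of allocation and remaining set is used: given `r = ρ`, the remaining set
has law `armsLaw`, whatever `ρ` is. A bound for each fixed set thus carries over to the random set
without a union bound over sets. -/
lemma measure_alloc_arms_le (hr : IsReallocationRule realloc) (hT : 2 < T)
    {Bad : (Fin K → Fin M) → Finset (Fin K) → Prop} {η : ℝ≥0∞}
    (hη : ∀ S, μ {ω | Bad (fun k => r k ω) S} ≤ η) (n : ℕ) :
    μ {ω | Bad (fun k => r k ω)
      (run T realloc (fun t i k => X t i k ω) (fun k => r k ω) n).holding.arms} ≤ η := by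
  classical
  rw [← he.sum_measure_alloc_inter]
  calc ∑ ρ, μ ({ω | (fun k => r k ω) = ρ} ∩ {ω | Bad (fun k => r k ω)
        (run T realloc (fun t i k => X t i k ω) (fun k => r k ω) n).holding.arms})
      ≤ ∑ ρ, ∑ S, μ {ω | (fun k => r k ω) = ρ} *
          (if Bad ρ S then armsLaw P M T n S else 0) := by
        refine Finset.sum_le_sum fun ρ _ => ?_
        have hsub : ({ω | (fun k => r k ω) = ρ} ∩ {ω | Bad (fun k => r k ω)
            (run T realloc (fun t i k => X t i k ω) (fun k => r k ω) n).holding.arms}) ⊆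
            ⋃ S ∈ (Finset.univ : Finset (Finset (Fin K))), {ω | (fun k => r k ω) = ρ} ∩
              {ω | Bad ρ S ∧ (run T realloc (fun t i k => X t i k ω) ρ n).holding.arms = S} := by
          rintro ω ⟨h1, h2⟩
          have h1' : (fun k => r k ω) = ρ := h1
          simp only [Set.mem_ofPred_eq] at h2
          rw [h1'] at h2
          simp only [Set.mem_iUnion]
          exact ⟨_, Finset.mem_univ _, h1, h2, rfl⟩
        refine (measure_mono hsub).trans ((measure_biUnion_finset_le _ _).trans ?_)
        refine Finset.sum_le_sum fun S _ => ?_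
        by_cases hb : Bad ρ S
        · simp only [hb, true_and, if_true]
          have hB : MeasurableSet {x : ℕ × Fin M × Fin K → ℝ |
              (run T realloc (fun t i k => x (t, i, k)) ρ n).holding.arms = S} :=
            measurableSet_arms_eq (X := fun t i k (x : ℕ × Fin M × Fin K → ℝ) => x (t, i, k))
              (fun t i k => measurable_pi_apply _) ρ n S
          have h := he.measure_alloc_inter ρ hB
          refine h.le.trans (le_of_eq ?_)
          rw [← measure_arms_eq he.measurable_reward he.law_reward he.indep_reward ρ hr hT n S]
          rfl
        · simp [hb]
    _ = ∑ S, armsLaw P M T n S * μ {ω | Bad (fun k => r k ω) S} := by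
        rw [Finset.sum_comm]
        refine Finset.sum_congr rfl fun S _ => ?_
        rw [← he.sum_measure_alloc_inter, Finset.mul_sum]
        refine Finset.sum_congr rfl fun ρ _ => ?_
        have : ({ω | (fun k => r k ω) = ρ} ∩ {ω | Bad (fun k => r k ω) S}) =
            if Bad ρ S then {ω | (fun k => r k ω) = ρ} else ∅ := by
          ext ω
          split_ifs with hb
          · simp only [Set.mem_inter_iff, Set.mem_ofPred_eq, and_iff_left_iff_imp]
            intro h; rwa [h]
          · simp only [Set.mem_inter_iff, Set.mem_ofPred_eq, Set.mem_empty_iff_false, iff_false]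
            rintro ⟨h, h'⟩
            rw [h] at h'
            exact hb h'
        rw [this]
        split_ifs
        · rw [mul_comm]
        · simp
    _ ≤ ∑ S, armsLaw P M T n S * η := by gcongr; exact hη _
    _ = η := by
        rw [← Finset.sum_mul, sum_armsLaw he.measurable_reward he.law_reward he.indep_reward hr hT,
          one_mul]

lemma measure_not_spread_le (hr : IsReallocationRule realloc) (hT : 2 < T) (H : ℕ) :
    μ {ω | ¬ ∀ n < T, Balanced (split (fun k => r k ω)
        (run T realloc (fun t i k => X t i k ω) (fun k => r k ω) n).holding.arms) ∨
        (run T realloc (fun t i k => X t i k ω) (fun k => r k ω) n).holding.arms.card ≤ H} ≤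
      T * (M * ENNReal.ofReal (2 * Real.exp (-(H / (36 * M))))) := by
  have hsub : {ω | ¬ ∀ n < T, Balanced (split (fun k => r k ω)
        (run T realloc (fun t i k => X t i k ω) (fun k => r k ω) n).holding.arms) ∨
        (run T realloc (fun t i k => X t i k ω) (fun k => r k ω) n).holding.arms.card ≤ H} ⊆
      ⋃ n ∈ Finset.range T, {ω | (fun ρ (S : Finset (Fin K)) => ¬ Balanced (split ρ S) ∧ H < S.card)
        (fun k => r k ω)
        (run T realloc (fun t i k => X t i k ω) (fun k => r k ω) n).holding.arms} := by
    intro ω hω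
    simp only [Set.mem_ofPred_eq, not_forall, not_or, not_le] at hω
    obtain ⟨n, hn, h⟩ := hω
    simp only [Set.mem_iUnion, Finset.mem_range]
    exact ⟨n, hn, h⟩
  refine (measure_mono hsub).trans ((measure_biUnion_finset_le _ _).trans ?_)
  refine (Finset.sum_le_card_nsmul _ _ (M * ENNReal.ofReal (2 * Real.exp (-(H / (36 * M)))))
    fun n _ => he.measure_alloc_arms_le hr hT
    -- Including the size in the bad event makes sets with at most `H` arms contribute nothing, and
    -- larger ones satisfy the Chernoff bound with `H` in place of their size.
    (Bad := fun ρ S => ¬ Balanced (split ρ S) ∧ H < S.card) ?_ n).trans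
    (le_of_eq (by rw [Finset.card_range, nsmul_eq_mul]))
  intro S
  by_cases hS : H < S.card
  · have hS' : (H : ℝ) ≤ S.card := by exact_mod_cast hS.le
    refine (measure_mono fun ω hω => hω.1).trans ((measure_not_balanced_split_le
      he.measurable_alloc he.law_alloc he.indep_alloc S).trans ?_)
    gcongr
  · simp [hS]

end IsEnvironment

end Environment

/-! ### Measurability of the regret and of the communication cost -/

/-- Serves for the random allocation, and for the random index of the phase running at a given time.
-/
lemma measurable_apply_countable {Ω ι β : Type*} [MeasurableSpace Ω] [Countable ι]
    [MeasurableSpace ι] [MeasurableSingletonClass ι] [MeasurableSpace β] {N : Ω → ι}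
    (hN : Measurable N) {g : ι → Ω → β} (hg : ∀ i, Measurable (g i)) :
    Measurable fun ω => g (N ω) ω := by
  intro s hs
  have : (fun ω => g (N ω) ω) ⁻¹' s = ⋃ i, N ⁻¹' {i} ∩ (g i) ⁻¹' s := by
    ext ω; simp
  rw [this]
  exact MeasurableSet.iUnion fun i => (hN (measurableSet_singleton i)).inter (hg i hs)

section Measurability

variable {Ω : Type*} [MeasurableSpace Ω] {M K : ℕ} [NeZero K] (T : ℕ)
  (realloc : ℕ → (Fin M → Finset (Fin K)) → (Fin M → Finset (Fin K)))
  {X : ℕ → Fin M → Fin K → Ω → ℝ} (hX : ∀ t i k, Measurable (X t i k)) (ρ : Fin K → Fin M)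

include hX

lemma measurable_comp_run {β : Type*} [MeasurableSpace β] (f : State M K → β) (n : ℕ) :
    Measurable fun ω => f (run T realloc (fun t i k => X t i k ω) ρ n) :=
  fun s _ => measurableSet_run_mem T realloc ρ hX n {S | f S ∈ s}

lemma measurable_regret (P : Fin K → Measure ℝ) :
    Measurable fun ω => regret P T realloc (fun t i k => X t i k ω) ρ := by
  refine Finset.measurable_sum _ fun t _ => Finset.measurable_sum _ fun i _ => ?_
  exact measurable_apply_countable
    (N := fun ω => Nat.findGreatest
      (fun n => (run T realloc (fun t i k => X t i k ω) ρ n).time ≤ t) t)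
    (g := fun n ω => gap P (armAt (pullsPerArm M K T (n + 1))
      (prepare (realloc (n + 1)) (run T realloc (fun t i k => X t i k ω) ρ n).holding)
      (t - (run T realloc (fun t i k => X t i k ω) ρ n).time) i))
    (measurable_findGreatest fun n _ =>
      measurableSet_run_mem T realloc ρ hX n {S | S.time ≤ t})
    fun n => measurable_comp_run T realloc hX ρ (fun S => gap P (armAt (pullsPerArm M K T (n + 1))
      (prepare (realloc (n + 1)) S.holding) (t - S.time) i)) n

lemma measurable_commCost :
    Measurable fun ω => (commCost T realloc (fun t i k => X t i k ω) ρ : ℝ) := by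
  simp only [commCost, Nat.cast_sum]
  refine Finset.measurable_sum _ fun n _ => ?_
  exact measurable_comp_run T realloc hX ρ (fun S =>
    (((if S.time < T then prepareCost S.holding + scheduleCost (pullsPerArm M K T (n + 1))
        (prepare (realloc (n + 1)) S.holding) else 0) +
      (if S.time + phaseLength (pullsPerArm M K T (n + 1))
        (prepare (realloc (n + 1)) S.holding) ≤ T then reportCost (pullsPerArm M K T (n + 1))
        (prepare (realloc (n + 1)) S.holding) else 0) : ℕ) : ℝ)) n

end Measurability

/-! ### Expectations -/

/-- Splits the expectation: `a` on the good event, the deterministic bound `b` on the exceptional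
one. -/
lemma integrable_and_integral_le {Ω : Type*} [MeasurableSpace Ω] {μ : Measure Ω}
    [IsProbabilityMeasure μ] {f : Ω → ℝ} (hf : Measurable f) {a b η : ℝ} (ha : 0 ≤ a) (hη : 0 ≤ η)
    (h0 : ∀ ω, 0 ≤ f ω) (hb : ∀ ω, f ω ≤ b) (h : μ {ω | a < f ω} ≤ ENNReal.ofReal η) :
    Integrable f μ ∧ ∫ ω, f ω ∂μ ≤ a + b * η := by
  obtain ⟨ω₀⟩ : Nonempty Ω := nonempty_of_isProbabilityMeasure μ
  have hb0 : 0 ≤ b := (h0 ω₀).trans (hb ω₀)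
  have hint : Integrable f μ := Integrable.of_bound hf.aestronglyMeasurable b
    (Filter.Eventually.of_forall fun ω => by rw [Real.norm_eq_abs, abs_of_nonneg (h0 ω)]; exact hb ω)
  have hms : MeasurableSet {ω | a < f ω} := measurableSet_lt measurable_const hf
  have hind : Integrable ({ω | a < f ω}.indicator (1 : Ω → ℝ)) μ :=
    (integrable_const (1 : ℝ)).indicator hms
  refine ⟨hint, ?_⟩
  calc ∫ ω, f ω ∂μ ≤ ∫ ω, (a + b * ({ω | a < f ω}.indicator (1 : Ω → ℝ)) ω) ∂μ := by
        refine integral_mono hint ((integrable_const a).add (hind.const_mul b)) fun ω => ?_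
        by_cases hω : a < f ω
        · have := hb ω
          simp [hω]
          linarith
        · simp [hω]
          exact not_lt.1 hω
    _ = a + b * μ.real {ω | a < f ω} := by
        rw [integral_add (integrable_const a) (hind.const_mul b), integral_const_mul,
          integral_indicator_one hms]
        simp
    _ ≤ a + b * η := by
        gcongr
        exact ENNReal.toReal_le_of_le_ofReal hη h

lemma regret_nonneg {M K : ℕ} [NeZero K] (P : Fin K → Measure ℝ) (T : ℕ)
    (realloc : ℕ → (Fin M → Finset (Fin K)) → (Fin M → Finset (Fin K)))
    (x : ℕ → Fin M → Fin K → ℝ) (ρ : Fin K → Fin M) : 0 ≤ regret P T realloc x ρ :=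
  Finset.sum_nonneg fun _ _ => Finset.sum_nonneg fun _ _ => gap_nonneg P _

lemma one_lt_log_of_two_lt {T : ℕ} (hT : 2 < T) : 1 < Real.log T := by
  simpa using log_horizon_pos (M := 1) (K := 1) hT

lemma sub_one_le_mul_log (M : ℕ) [NeZero M] : (M : ℝ) - 1 ≤ M * Real.log M := by
  have hM : (0 : ℝ) < M := by exact_mod_cast NeZero.pos M
  have h := mul_le_mul_of_nonneg_left (Real.one_sub_inv_le_log_of_pos hM) hM.le
  have e : (M : ℝ) * (1 - (M : ℝ)⁻¹) = M - 1 := by field_simp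
  linarith

lemma natLog_add_two_le {T : ℕ} (hT : 2 < T) : ((Nat.log 2 T + 2 : ℕ) : ℝ) ≤ 4 * Real.log T := by
  have h1 : ((2 ^ Nat.log 2 T : ℕ) : ℝ) ≤ T := by exact_mod_cast Nat.pow_log_le_self 2 (by omega)
  have h2 := Real.log_le_log (by positivity) h1
  rw [Nat.cast_pow, Real.log_pow] at h2
  have h3 := Real.log_two_gt_d9
  have h4 := one_lt_log_of_two_lt hT
  have h5 : (0 : ℝ) ≤ Nat.log 2 T := Nat.cast_nonneg _
  have h6 : (Nat.log 2 T : ℝ) * (1 / 2) ≤ Nat.log 2 T * Real.log (2 : ℕ) := by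
    refine mul_le_mul_of_nonneg_left ?_ h5
    push_cast
    linarith
  have h7 := h6.trans h2
  push_cast
  linarith

/-! ### The three bounds with explicit constants. -/

section Environment

variable {Ω : Type*} [MeasurableSpace Ω] {M K T : ℕ} [NeZero M] [NeZero K] {P : Fin K → Measure ℝ}
  [∀ k, IsProbabilityMeasure (P k)]
  {X : ℕ → Fin M → Fin K → Ω → ℝ} {r : Fin K → Ω → Fin M} {μ : Measure Ω}
  [IsProbabilityMeasure μ]
  {realloc : ℕ → (Fin M → Finset (Fin K)) → (Fin M → Finset (Fin K))}

namespace IsEnvironment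

variable (he : IsEnvironment P X r μ) (hr : IsReallocationRule realloc) (hT : 2 < T) (hMT : M < T)
  (hKT : K < T)

include he hr hT hMT hKT

theorem integral_regret_le (hP : ∀ k, ∀ᵐ y ∂(P k), y ∈ Set.Icc (0 : ℝ) 1) :
    Integrable (fun ω => regret P T realloc (fun t i k => X t i k ω) (fun k => r k ω)) μ ∧
      ∫ ω, regret P T realloc (fun t i k => X t i k ω) (fun k => r k ω) ∂μ ≤
        16387 * ((∑ k with 0 < gap P k, (gap P k)⁻¹ * Real.log T) + M * Real.log M) := by
  have hM : (1 : ℝ) ≤ M := by exact_mod_cast NeZero.one_le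
  have hK : (1 : ℝ) ≤ K := by exact_mod_cast NeZero.one_le
  have hT' : (3 : ℝ) ≤ T := by exact_mod_cast hT
  have hgap := gap_le_one P hP
  have hmeas : Measurable fun ω => regret P T realloc (fun t i k => X t i k ω) (fun k => r k ω) :=
    measurable_apply_countable (measurable_pi_iff.2 he.measurable_alloc)
      fun ρ => measurable_regret T realloc he.measurable_reward ρ P
  have hlT := one_lt_log_of_two_lt hT
  have hL := log_horizon_le (M := M) (K := K) hMT hKT
  have hL1 := log_horizon_pos (M := M) (K := K) hT
  set L := Real.log ((M : ℝ) * K * T) with hLdef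
  set Γ := ∑ k with 0 < gap P k, (gap P k)⁻¹ with hΓ
  have hΓ0 : 0 ≤ Γ := Finset.sum_nonneg fun k hk => (inv_pos.2 (Finset.mem_filter.1 hk).2).le
  have hMlog := sub_one_le_mul_log M
  rw [← Finset.sum_mul, ← hΓ]
  -- A positive gap makes `Γ * log T ≥ 1`, which absorbs the contribution of the exceptional event.
  -- Without one the claimed bound may be `0` (for `M = 1`), but then the regret vanishes.
  by_cases hpos : ∃ k, 0 < gap P k
  · obtain ⟨k₀, hk₀⟩ := hpos
    have hΓ1 : 1 ≤ Γ := by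
      refine le_trans ((one_le_inv₀ hk₀).2 (hgap k₀)) ?_
      exact Finset.single_le_sum (f := fun k => (gap P k)⁻¹)
        (fun k hk => (inv_pos.2 (Finset.mem_filter.1 hk).2).le)
        (Finset.mem_filter.2 ⟨Finset.mem_univ _, hk₀⟩)
    set Z : ℝ := (M : ℝ) * K * T with hZ
    have hTZ : (T : ℝ) ≤ Z := by
      rw [hZ]
      exact le_mul_of_one_le_left (by linarith) (one_le_mul_of_one_le_of_one_le hM hK)
    have hZ0 : 0 < Z := by linarith
    have hprob : μ {ω | 5462 * (Γ * L) + 4 * (M - 1) <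
        regret P T realloc (fun t i k => X t i k ω) (fun k => r k ω)} ≤
        ENNReal.ofReal (T * K * (2 * Z⁻¹ ^ 3)) := by
      rw [ENNReal.ofReal_mul (by positivity), ENNReal.ofReal_mul (by positivity),
        ENNReal.ofReal_natCast, ENNReal.ofReal_natCast]
      refine (measure_mono fun ω hω hacc => ?_).trans
        (he.measure_not_accurate_le (T := T) (realloc := realloc) hP hr hT)
      have := Accurate.regret_le hr hT hacc hgap
      rw [← Finset.sum_mul] at this
      exact absurd (Set.mem_ofPred.1 hω) (not_lt.2 this)
    obtain ⟨h1, h2⟩ := integrable_and_integral_le hmeas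
      (add_nonneg (by positivity) (by linarith)) (by positivity) (fun ω => regret_nonneg P T realloc _ _)
      (fun ω => regret_le_mul (M := M) P _ _ hgap) hprob
    refine ⟨h1, h2.trans ?_⟩
    -- The trivial regret `M T` times the failure probability is `2 T / Z^2`, and `Z ≥ T ≥ 3`.
    have h3 : (M : ℝ) * T * (T * K * (2 * Z⁻¹ ^ 3)) ≤ 1 := by
      have e : (M : ℝ) * T * (T * K * (2 * Z⁻¹ ^ 3)) = 2 * T * Z⁻¹ ^ 2 := by
        have : (M : ℝ) * T * (T * K * (2 * Z⁻¹ ^ 3)) = 2 * T * (Z * Z⁻¹) * Z⁻¹ ^ 2 := by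
          rw [hZ]; ring
        rw [this, mul_inv_cancel₀ hZ0.ne', mul_one]
      rw [e, inv_pow, ← div_eq_mul_inv, div_le_one (by positivity)]
      nlinarith
    have h4 : Γ * L ≤ 3 * (Γ * Real.log T) := by nlinarith
    have h5 : 1 ≤ Γ * Real.log T := one_le_mul_of_one_le_of_one_le hΓ1 hlT.le
    have h6 : 0 ≤ (M : ℝ) * Real.log M := by linarith
    linarith
  · have hzero : ∀ k, gap P k = 0 := fun k =>
      le_antisymm (not_lt.1 fun h => hpos ⟨k, h⟩) (gap_nonneg P k)
    have hreg : (fun ω => regret P T realloc (fun t i k => X t i k ω) (fun k => r k ω)) =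
        fun _ => 0 := by
      funext ω
      simp [regret, hzero]
    rw [hreg]
    refine ⟨integrable_const _, ?_⟩
    have h6 : 0 ≤ (M : ℝ) * Real.log M := by linarith
    simp only [integral_zero]
    positivity

omit hKT [∀ k, IsProbabilityMeasure (P k)] in
lemma measure_commCost_gt_le {δ : ℝ} (hδ : 0 < δ) (hδ1 : δ < 1) :
    μ {ω | 652 * (M * Real.log (T / δ)) <
        (commCost T realloc (fun t i k => X t i k ω) (fun k => r k ω) : ℝ)} ≤
      ENNReal.ofReal δ := by
  have hM : (1 : ℝ) ≤ M := by exact_mod_cast NeZero.one_le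
  have hM' : (M : ℝ) ≤ T := by exact_mod_cast hMT.le
  have hT' : (3 : ℝ) ≤ T := by exact_mod_cast hT
  have hlT := one_lt_log_of_two_lt hT
  set Λ := Real.log (T / δ) with hΛ
  have hΛT : Real.log T ≤ Λ := by
    refine Real.log_le_log (by linarith) ?_
    rw [le_div_iff₀ hδ]
    nlinarith
  -- `144 = 4 * 36` makes the Chernoff factor at most `(δ / T)^4`, enough for the union over `T`
  -- phases and `M < T` agents. The cost is then at most `72 + 4 * 144 + 4 = 652` times `M Λ`, the
  -- last `4` coming from the rounding of `H`.
  set H := ⌈144 * (M * Λ)⌉₊ with hH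
  have hΛM : 1 ≤ (M : ℝ) * Λ := one_le_mul_of_one_le_of_one_le hM (by linarith)
  have hH1 : 144 * (M * Λ) ≤ H := Nat.le_ceil _
  have hH2 : (H : ℝ) ≤ 144 * (M * Λ) + 1 := (Nat.ceil_lt_add_one (by positivity)).le
  refine (measure_mono fun ω hω hsp => ?_).trans
    ((he.measure_not_spread_le (T := T) (realloc := realloc) hr hT H).trans ?_)
  · have h1 := commCost_le hr _ _ hT hMT hsp
    have h2 : (commCost T realloc (fun t i k => X t i k ω) (fun k => r k ω) : ℝ) ≤
        18 * M * ((Nat.log 2 T + 2 : ℕ) : ℝ) + 4 * H := by exact_mod_cast h1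
    have h3 : 18 * (M : ℝ) * ((Nat.log 2 T + 2 : ℕ) : ℝ) ≤ 18 * M * (4 * Λ) := by
      gcongr
      exact (natLog_add_two_le hT).trans (by linarith)
    have h4 := Set.mem_ofPred.1 hω
    linarith
  · rw [← ENNReal.ofReal_natCast T, ← ENNReal.ofReal_natCast M,
      ← ENNReal.ofReal_mul (by positivity), ← ENNReal.ofReal_mul (by positivity)]
    refine ENNReal.ofReal_le_ofReal ?_
    have h1 : Real.exp (-(H / (36 * M))) ≤ (δ / T) ^ 4 := by
      have e : (δ / T) ^ 4 = Real.exp (-(4 * Λ)) := by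
        rw [Real.exp_neg, show (4 : ℝ) * Λ = ((4 : ℕ) : ℝ) * Λ by norm_num, Real.exp_nat_mul, hΛ,
          Real.exp_log (by positivity), ← inv_pow, inv_div]
      rw [e]
      refine Real.exp_le_exp.2 (neg_le_neg ?_)
      rw [le_div_iff₀ (by positivity)]
      linarith
    calc (T : ℝ) * (M * (2 * Real.exp (-(H / (36 * M))))) ≤ T * (T * (2 * (δ / T) ^ 4)) := by gcongr
      _ = 2 / T ^ 2 * (δ ^ 3 * δ) := by field_simp
      _ ≤ 1 * (1 * δ) := by
          gcongr
          · rw [div_le_one (by positivity)]; nlinarith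
          · exact pow_le_one₀ hδ.le hδ1.le
      _ = δ := by ring

omit [∀ k, IsProbabilityMeasure (P k)] [IsProbabilityMeasure μ] hr hT hMT hKT [NeZero M] in
lemma measurable_commCost :
    Measurable fun ω => (commCost T realloc (fun t i k => X t i k ω) (fun k => r k ω) : ℝ) :=
  measurable_apply_countable (measurable_pi_iff.2 he.measurable_alloc)
    fun ρ => DEMAB.measurable_commCost T realloc he.measurable_reward ρ

omit hKT [∀ k, IsProbabilityMeasure (P k)] in
theorem le_measure_commCost_le {δ : ℝ} (hδ : 0 < δ) (hδ1 : δ < 1) :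
    ENNReal.ofReal (1 - δ) ≤
      μ {ω | (commCost T realloc (fun t i k => X t i k ω) (fun k => r k ω) : ℝ) ≤
        652 * (M * Real.log (T / δ))} := by
  have h1 := he.measure_commCost_gt_le hr hT hMT hδ hδ1
  have hms : MeasurableSet {ω | 652 * (M * Real.log (T / δ)) <
        (commCost T realloc (fun t i k => X t i k ω) (fun k => r k ω) : ℝ)} :=
    measurableSet_lt measurable_const he.measurable_commCost
  have h2 := prob_compl_eq_one_sub (μ := μ) hms
  have h3 : {ω | 652 * (M * Real.log (T / δ)) <
        (commCost T realloc (fun t i k => X t i k ω) (fun k => r k ω) : ℝ)}ᶜ =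
      {ω | (commCost T realloc (fun t i k => X t i k ω) (fun k => r k ω) : ℝ) ≤
        652 * (M * Real.log (T / δ))} := by
    ext ω; simp
  rw [← h3, h2, ENNReal.ofReal_sub 1 hδ.le, ENNReal.ofReal_one]
  exact tsub_le_tsub_left h1 1

omit [∀ k, IsProbabilityMeasure (P k)] in
theorem integral_commCost_le :
    Integrable (fun ω => (commCost T realloc (fun t i k => X t i k ω) (fun k => r k ω) : ℝ)) μ ∧
      ∫ ω, (commCost T realloc (fun t i k => X t i k ω) (fun k => r k ω) : ℝ) ∂μ ≤
        1380 * (M * Real.log T) := by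
  have hM : (1 : ℝ) ≤ M := by exact_mod_cast NeZero.one_le
  have hT' : (3 : ℝ) ≤ T := by exact_mod_cast hT
  have hlT := one_lt_log_of_two_lt hT
  have hMl : 1 ≤ (M : ℝ) * Real.log T := one_le_mul_of_one_le_of_one_le hM hlT.le
  have hb : ∀ ω, (commCost T realloc (fun t i k => X t i k ω) (fun k => r k ω) : ℝ) ≤
      72 * (M * Real.log T) + 4 * T := by
    intro ω
    have h1 := commCost_le_of_horizon hr (fun t i k => X t i k ω) (fun k => r k ω) hT hMT hKT
    have h2 : (commCost T realloc (fun t i k => X t i k ω) (fun k => r k ω) : ℝ) ≤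
        18 * M * ((Nat.log 2 T + 2 : ℕ) : ℝ) + 4 * T := by exact_mod_cast h1
    have h3 : 18 * (M : ℝ) * ((Nat.log 2 T + 2 : ℕ) : ℝ) ≤ 18 * M * (4 * Real.log T) := by
      gcongr
      exact natLog_add_two_le hT
    linarith
  -- With `δ = 1 / T` the deterministic bound, of order `M log T + T`, contributes only `O(M log
  -- T)`. In total `1380 = 2 * 652 + 72 + 4`.
  have h1 := he.measure_commCost_gt_le hr hT hMT (δ := (T : ℝ)⁻¹) (by positivity)
    (inv_lt_one_of_one_lt₀ (by linarith))
  have e : Real.log (T / (T : ℝ)⁻¹) = 2 * Real.log T := by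
    rw [div_inv_eq_mul, Real.log_mul (by positivity) (by positivity)]; ring
  rw [e] at h1
  obtain ⟨h2, h3⟩ := integrable_and_integral_le
    he.measurable_commCost (by positivity) (by positivity) (fun ω => Nat.cast_nonneg _)
    hb h1
  refine ⟨h2, h3.trans ?_⟩
  have h4 : (72 * (M * Real.log T) + 4 * T) * (T : ℝ)⁻¹ ≤ 72 * (M * Real.log T) + 4 := by
    have h5 : (T : ℝ)⁻¹ ≤ 1 := inv_le_one_of_one_le₀ (by linarith)
    have h6 : 72 * (M * Real.log T) * (T : ℝ)⁻¹ ≤ 72 * (M * Real.log T) :=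
      mul_le_of_le_one_right (by positivity) h5
    have h7 : 4 * (T : ℝ) * (T : ℝ)⁻¹ = 4 := by field_simp
    linarith
  linarith

end IsEnvironment

end Environment

end DEMAB

theorem theorem5 :
    ∃ C : ℝ, 0 < C ∧
      ∀ (M K T : ℕ) [NeZero M] [NeZero K],
        (M : ℝ) * Real.log M / K < T → M < T → K < T → 2 < T →
      ∀ (P : Fin K → Measure ℝ) [∀ k, IsProbabilityMeasure (P k)],
        (∀ k, ∀ᵐ y ∂(P k), y ∈ Set.Icc (0 : ℝ) 1) →
      ∀ (realloc : ℕ → (Fin M → Finset (Fin K)) → (Fin M → Finset (Fin K))),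
        DEMAB.IsReallocationRule realloc →
      ∀ (Ω : Type*) [MeasurableSpace Ω] (μ : Measure Ω) [IsProbabilityMeasure μ]
        (X : ℕ → Fin M → Fin K → Ω → ℝ) (r : Fin K → Ω → Fin M),
        DEMAB.IsEnvironment P X r μ →
      let Reg : Ω → ℝ := fun ω =>
        DEMAB.regret P T realloc (fun t i k => X t i k ω) (fun k => r k ω)
      let Comm : Ω → ℝ := fun ω =>
        (DEMAB.commCost T realloc (fun t i k => X t i k ω) (fun k => r k ω) : ℝ)
      (Integrable Reg μ ∧
        ∫ ω, Reg ω ∂μ ≤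
          C * ((∑ k with 0 < DEMAB.gap P k, (DEMAB.gap P k)⁻¹ * Real.log T) +
            M * Real.log M)) ∧
      (∀ δ : ℝ, 0 < δ → δ < 1 →
        ENNReal.ofReal (1 - δ) ≤ μ {ω | Comm ω ≤ C * (M * Real.log (T / δ))}) ∧
      (Integrable Comm μ ∧ ∫ ω, Comm ω ∂μ ≤ C * (M * Real.log T)) := by
  -- The largest of the three constants: `3 * 5462 + 1`, with `3` from `log (MKT) ≤ 3 log T` and `1`
  -- from the inaccurate executions.
  refine ⟨16387, by norm_num, ?_⟩
  intro M K T _ _ _ hMT hKT hT P _ hP realloc hr Ω _ μ _ X r he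
  have hM : (0 : ℝ) < M := by exact_mod_cast NeZero.pos M
  have hT0 : (0 : ℝ) < T := by exact_mod_cast (by omega : 0 < T)
  have hlT : 0 < Real.log T := zero_lt_one.trans (DEMAB.one_lt_log_of_two_lt hT)
  refine ⟨he.integral_regret_le hr hT hMT hKT hP, fun δ hδ hδ1 => ?_, ?_⟩
  · refine (he.le_measure_commCost_le hr hT hMT hδ hδ1).trans (measure_mono fun ω hω => ?_)
    refine le_trans (Set.mem_ofPred.1 hω) (mul_le_mul_of_nonneg_right (by norm_num) ?_)
    refine mul_nonneg hM.le (hlT.le.trans (Real.log_le_log hT0 ?_))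
    exact le_div_self hT0.le hδ hδ1.le
  · obtain ⟨h1, h2⟩ := he.integral_commCost_le hr hT hMT hKT
    exact ⟨h1, h2.trans (mul_le_mul_of_nonneg_right (by norm_num) (by positivity))⟩
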